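/- For $0\le\theta<2\pi$ let $\gamma_\theta=\{\,i-ie^{iu}:0<u\le\theta\,\}$ be the arc of the circle with centre $i$ and radius $1$ (tangent to $\mathbb R$ at the origin) that starts at the origin in the positive direction. Let $\mathbb H$ be the open upper half-plane. For a continuous real function $\lambda$ on $[0,T)$, $T>0$, consider the chordal L\"owner equation $$\frac{\partial h(z,t)}{\partial t}=\frac{2}{h(z,t)-\lambda(t)},\qquad h(z,0)=z\in\mathbb H,$$ and let $K_t$ be its hull at time $t$, that is, the set of $z\in\mathbb H$ whose solution does not exist on all of $[0,t]$. Say that $\lambda$ generates the circular slit on $[0,T)$ if for every $t\in[0,T)$ there is $\theta\in[0,2\pi)$ with $K_t=\gamma_\theta$. (a) There are $T>0$ and a $\lambda$ that generates the circular slit on $[0,T)$ such that every arc $\gamma_\theta$, $0\le\theta<2\pi$, occurs as some $K_t$, $t\in[0,T)$. (b) Let $\lambda$ generate the circular slit on $[0,T)$. Then: 1. $\lambda(0)=0$ and, for small $t\ge0$, $$\lambda(t)=\lambda(0)+(12\pi)^{1/3}t^{1/3}+\dots,$$ where the dots stand for $t^{2/3}R(t^{1/3})$ with $R$ real-analytic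 at $0$, i.e. for a convergent series of higher powers of $t^{1/3}$. 2. $\lambda$ is H\"older continuous with exponent $1/3$ on $[0,T)$, in particular about $t=0$, and it is real-analytic on $(0,T)$. 3. For $0<t<T$ the image $I(t)$ of the slit under the boundary extension of $h(\cdot,t)$ (the set of all limit values of $h(z,t)$ as $z\in\mathbb H\setminus K_t$ tends to a point of the closure of $K_t$) is a real interval $[\alpha(t),\beta(t)]$ with $\alpha(t)<\lambda(t)<\beta(t)$. The functions $\alpha,\beta$ satisfy $\alpha'=2/(\alpha-\lambda)$ and $\beta'=2/(\beta-\lambda)$ on $(0,T)$, and for small $t>0$ $$\alpha(t)=-\left(\frac{9}{4\pi}\right)^{1/3}t^{2/3}+\dots,\qquad \beta(t)=(12\pi)^{1/3}t^{1/3}+\dots,$$ where the dots stand for $t\,R_1(t^{1/3})$ and $t^{2/3}R_2(t^{1/3})$ respectively, with $R_1,R_2$ real-analytic at $0$. -/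

import Mathlib

open Set Filter Topology

/-- `g` solves the chordal Loewner equation `dg/ds = 2 / (g - lam)`, `g 0 = z`, on the closed
time interval `[0, t]` (in particular it does not meet the driving term there). -/
def IsLoewnerSolution (lam : ℝ → ℝ) (z : ℂ) (t : ℝ) (g : ℝ → ℂ) : Prop :=
  g 0 = z ∧ ∀ s ∈ Icc (0 : ℝ) t,
    g s ≠ (lam s : ℂ) ∧ HasDerivWithinAt g (2 / (g s - (lam s : ℂ))) (Icc 0 t) s

/-- The open upper half-plane, as a set of complex numbers. -/
def upperHalf : Set ℂ := {z | 0 < z.im}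

/-- The hull at time `t` of the chordal Loewner flow driven by `lam`: the points of the upper
half-plane whose solution does not exist up to and including time `t`. -/
def loewnerHull (lam : ℝ → ℝ) (t : ℝ) : Set ℂ :=
  {z | z ∈ upperHalf ∧ ¬ ∃ g, IsLoewnerSolution lam z t g}

open Classical in
/-- The flow map `z ↦ h(z, t)` of the chordal Loewner equation driven by `lam`; it is meaningful on
the complement of the hull in the upper half-plane (the value elsewhere is a dummy). -/
noncomputable def loewnerMap (lam : ℝ → ℝ) (t : ℝ) (z : ℂ) : ℂ :=
  if h : ∃ g, IsLoewnerSolution lam z t g then h.choose t else 0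

/-- The image of the hull under the boundary extension of `h(·, t)`: the set of all limit values of
`h(z, t)` as `z`, in the complement of the hull in the upper half-plane, approaches a point of the
closure of the hull. -/
def hullImage (lam : ℝ → ℝ) (t : ℝ) : Set ℂ :=
  {w | ∃ p ∈ closure (loewnerHull lam t),
    MapClusterPt w (𝓝[upperHalf \ loewnerHull lam t] p) (loewnerMap lam t)}

/-- The half-open arc of angle `θ` of the circle with centre `i` and radius `1`, starting at (and not
containing) the tangency point `0`, directed to the right, and containing its tip:
the points `i - i e^{iu} = sin u + i (1 - cos u)` for `0 < u ≤ θ`. -/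
def circularSlit (θ : ℝ) : Set ℂ :=
  {z | ∃ u : ℝ, 0 < u ∧ u ≤ θ ∧ z = Complex.I - Complex.I * Complex.exp (u * Complex.I)}

/-- `lam` is a continuous driving term on `[0, T)` whose chordal Loewner flow has, at every time, an
arc of the above circle as its hull. -/
def DrivesCircularSlit (lam : ℝ → ℝ) (T : ℝ) : Prop :=
  0 < T ∧ ContinuousOn lam (Ico 0 T) ∧
    ∀ t ∈ Ico (0 : ℝ) T, ∃ θ ∈ Ico (0 : ℝ) (2 * Real.pi), loewnerHull lam t = circularSlit θ

/-! The inversion `z ↦ -2π/z` preserves the upper half-plane, sends the circle to the line `Im = π`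
and turns each arc issuing from the origin into a ray on that line coming from `-∞`. The half-plane
minus such a ray is the image of the half-plane under the elementary map `ζ ↦ p (ζ - 1) + log ζ`
with `p > 0`, whose critical value, at `ζ = -1/p`, is the tip of the ray.

Put `p = (1 - r)/r` and `ζ = 1 - 2πr/(w + πr²)`. The shift `πr²` removes the `w⁻²` term, so the
composite `slitInvariant r w` is `-2π/w + O(w⁻³)` at infinity; equated with `-2π/z` it describes the
normalised map `w = h(z, t)` of the slit complement. The `w⁻³` coefficient is `-4πt`, which yields
`slitTime`; the critical point is `w = πr(2 - 3r)`, which yields `slitDriving`; the points `ζ = ∞`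
and `ζ = 0`, both sent to the root of the slit, yield `slitLeft` and `slitRight`. The proof goes the
other way: these formulas are definitions, the invariant is shown to be constant along the flow
(`slitInvariant_eq`), and its range (`slitInvariant_mem`, `exists_slitInvariant_eq`) identifies the
hulls. Injectivity of the elementary map is never needed, because the flow supplies the inverse.

An arbitrary driving term of the slit is reduced to this one by uniqueness. A hull determines its
inverse flow map (`loewnerInv_eq_of_loewnerHull_eq`), hence its capacity `2t` and the time
(`time_eq_of_loewnerHull_eq`); the family of hulls then determines the velocity of a trajectory,
hence the driving term (`driving_eq_of_loewnerHull_eq`).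

The singular behaviour at `t = 0` comes from `slitTime r = (2π²/3) r³ (1 - 3r/4)`: its cube root is
an analytic local coordinate, so `r` is an analytic function of `t^(1/3)`, and `λ`, `α`, `β` are
quadratic polynomials in `r`. -/

/-! ### Solutions of the Loewner equation: differences, uniqueness, imaginary parts. -/

theorem isOpen_upperHalf : IsOpen upperHalf :=
  isOpen_lt continuous_const Complex.continuous_im

theorem convex_upperHalf : Convex ℝ upperHalf := convex_halfSpace_im_gt 0

theorem isConnected_upperHalf : IsConnected upperHalf :=
  ⟨⟨Complex.I, by simp [upperHalf]⟩, convex_upperHalf.isPreconnected⟩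

theorem sub_ofReal_ne_zero_of_mem_upperHalf {w : ℂ} (hw : w ∈ upperHalf) (x : ℝ) :
    w - (x : ℂ) ≠ 0 := by
  intro h
  have := congrArg Complex.im h
  simp only [Complex.sub_im, Complex.ofReal_im, sub_zero, Complex.zero_im] at this
  exact (ne_of_gt hw) this

theorem im_le_norm_sub_ofReal (w : ℂ) (x : ℝ) : w.im ≤ ‖w - (x : ℂ)‖ := by
  have := Complex.abs_im_le_norm (w - (x : ℂ))
  simp only [Complex.sub_im, Complex.ofReal_im, sub_zero] at this
  exact (le_abs_self _).trans this

theorem eqOn_const_of_hasDerivWithinAt_zero {e : ℝ → ℂ} {t : ℝ}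
    (he : ∀ s ∈ Icc (0 : ℝ) t, HasDerivWithinAt e 0 (Icc 0 t) s) :
    ∀ s ∈ Icc (0 : ℝ) t, e s = e 0 :=
  constant_of_has_deriv_right_zero (fun s hs => (he s hs).continuousWithinAt) fun s hs =>
    (he s (Ico_subset_Icc_self hs)).mono_of_mem_nhdsWithin (Icc_mem_nhdsGE_of_mem hs)

/-- Solutions of a scalar linear equation are given by the exponential of the integral. -/
theorem eq_mul_exp_integral_of_hasDerivWithinAt {d a : ℝ → ℂ} {t : ℝ}
    (ha : ContinuousOn a (Icc 0 t))
    (hd : ∀ s ∈ Icc (0 : ℝ) t, HasDerivWithinAt d (a s * d s) (Icc 0 t) s) :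
    ∀ s ∈ Icc (0 : ℝ) t, d s = d 0 * Complex.exp (∫ x in (0 : ℝ)..s, a x) := by
  intro s hs
  have hA : ∀ s ∈ Icc (0 : ℝ) t,
      HasDerivWithinAt (fun s => ∫ x in (0 : ℝ)..s, a x) (a s) (Icc 0 t) s := by
    intro s hs
    have : Fact (s ∈ Icc (0 : ℝ) t) := ⟨hs⟩
    refine intervalIntegral.integral_hasDerivWithinAt_right ?_
      (ha.stronglyMeasurableAtFilter_nhdsWithin measurableSet_Icc s) (ha s hs)
    refine (ha.mono ?_).intervalIntegrable
    rw [uIcc_of_le hs.1]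
    exact Icc_subset_Icc_right hs.2
  have key := eqOn_const_of_hasDerivWithinAt_zero
    (e := fun s => d s * Complex.exp (-∫ x in (0 : ℝ)..s, a x)) (t := t) (fun s hs => by
      have h1 := (hA s hs).neg.cexp
      have h2 := (hd s hs).mul h1
      refine h2.congr_deriv ?_
      simp only [Pi.neg_apply]
      ring) s hs
  simp only [intervalIntegral.integral_same, neg_zero, Complex.exp_zero, mul_one] at key
  rw [← key, mul_assoc, ← Complex.exp_add, neg_add_cancel, Complex.exp_zero, mul_one]

theorem IsLoewnerSolution.continuousOn {lam : ℝ → ℝ} {z : ℂ} {t : ℝ} {g : ℝ → ℂ}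
    (h : IsLoewnerSolution lam z t g) : ContinuousOn g (Icc 0 t) :=
  fun s hs => (h.2 s hs).2.continuousWithinAt

theorem IsLoewnerSolution.continuousOn_sub {lam : ℝ → ℝ} {z : ℂ} {t : ℝ} {g : ℝ → ℂ}
    (hlam : ContinuousOn lam (Icc 0 t)) (h : IsLoewnerSolution lam z t g) :
    ContinuousOn (fun s => g s - (lam s : ℂ)) (Icc 0 t) :=
  h.continuousOn.sub (Complex.continuous_ofReal.comp_continuousOn hlam)

theorem IsLoewnerSolution.sub_ne_zero {lam : ℝ → ℝ} {z : ℂ} {t : ℝ} {g : ℝ → ℂ}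
    (h : IsLoewnerSolution lam z t g) {s : ℝ} (hs : s ∈ Icc 0 t) : g s - (lam s : ℂ) ≠ 0 :=
  _root_.sub_ne_zero.2 (h.2 s hs).1

theorem IsLoewnerSolution.continuousOn_coeff {lam : ℝ → ℝ} {z₁ z₂ : ℂ} {t : ℝ} {g₁ g₂ : ℝ → ℂ}
    (hlam : ContinuousOn lam (Icc 0 t)) (h₁ : IsLoewnerSolution lam z₁ t g₁)
    (h₂ : IsLoewnerSolution lam z₂ t g₂) :
    ContinuousOn (fun s => -2 / ((g₁ s - (lam s : ℂ)) * (g₂ s - (lam s : ℂ)))) (Icc 0 t) :=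
  continuousOn_const.div ((h₁.continuousOn_sub hlam).mul (h₂.continuousOn_sub hlam))
    fun _ hs => mul_ne_zero (h₁.sub_ne_zero hs) (h₂.sub_ne_zero hs)

/-- The difference of two solutions of the Loewner equation. -/
theorem IsLoewnerSolution.sub_eq {lam : ℝ → ℝ} {z₁ z₂ : ℂ} {t : ℝ} {g₁ g₂ : ℝ → ℂ}
    (hlam : ContinuousOn lam (Icc 0 t)) (h₁ : IsLoewnerSolution lam z₁ t g₁)
    (h₂ : IsLoewnerSolution lam z₂ t g₂) {s : ℝ} (hs : s ∈ Icc 0 t) :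
    g₁ s - g₂ s = (z₁ - z₂) * Complex.exp
      (∫ x in (0 : ℝ)..s, -2 / ((g₁ x - (lam x : ℂ)) * (g₂ x - (lam x : ℂ)))) := by
  have := eq_mul_exp_integral_of_hasDerivWithinAt (d := fun s => g₁ s - g₂ s)
    (h₁.continuousOn_coeff hlam h₂) (fun s hs => by
      refine ((h₁.2 s hs).2.sub (h₂.2 s hs).2).congr_deriv ?_
      have := h₁.sub_ne_zero hs
      have := h₂.sub_ne_zero hs
      field_simp
      ring) s hs
  simpa only [h₁.1, h₂.1] using this

theorem IsLoewnerSolution.eqOn {lam : ℝ → ℝ} {z : ℂ} {t : ℝ} {g₁ g₂ : ℝ → ℂ}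
    (hlam : ContinuousOn lam (Icc 0 t)) (h₁ : IsLoewnerSolution lam z t g₁)
    (h₂ : IsLoewnerSolution lam z t g₂) : EqOn g₁ g₂ (Icc 0 t) := by
  intro s hs
  have := h₁.sub_eq hlam h₂ hs
  rwa [sub_self, zero_mul, sub_eq_zero] at this

theorem IsLoewnerSolution.initial_eq {lam : ℝ → ℝ} {z₁ z₂ : ℂ} {t : ℝ} {g₁ g₂ : ℝ → ℂ}
    (hlam : ContinuousOn lam (Icc 0 t)) (h₁ : IsLoewnerSolution lam z₁ t g₁)
    (h₂ : IsLoewnerSolution lam z₂ t g₂) {s : ℝ} (hs : s ∈ Icc 0 t) (h : g₁ s = g₂ s) :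
    z₁ = z₂ := by
  have := h₁.sub_eq hlam h₂ hs
  rw [h, sub_self, eq_comm, mul_eq_zero, sub_eq_zero] at this
  exact this.resolve_right (Complex.exp_ne_zero _)

/-- Reflection makes twice the imaginary part a difference of two solutions, so that
`IsLoewnerSolution.sub_eq` shows it keeps its sign. -/
theorem IsLoewnerSolution.conj {lam : ℝ → ℝ} {z : ℂ} {t : ℝ} {g : ℝ → ℂ}
    (h : IsLoewnerSolution lam z t g) :
    IsLoewnerSolution lam (starRingEnd ℂ z) t (fun s => starRingEnd ℂ (g s)) := by
  refine ⟨congrArg _ h.1, fun s hs => ⟨fun h' => (h.2 s hs).1 ?_, ?_⟩⟩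
  · rw [← Complex.conj_conj (g s), ← Complex.conj_ofReal]
    exact congrArg _ h'
  · refine ((h.2 s hs).2.star).congr_deriv ?_
    simp

theorem IsLoewnerSolution.im_eq {lam : ℝ → ℝ} {z : ℂ} {t : ℝ} {g : ℝ → ℂ}
    (hlam : ContinuousOn lam (Icc 0 t)) (h : IsLoewnerSolution lam z t g) {s : ℝ}
    (hs : s ∈ Icc 0 t) :
    (g s).im = z.im * Real.exp (∫ x in (0 : ℝ)..s, -2 / Complex.normSq (g x - (lam x : ℂ))) := by
  have h1 := h.sub_eq hlam h.conj hs
  have h2 : ∀ x : ℝ, -2 / ((g x - (lam x : ℂ)) * (starRingEnd ℂ (g x) - (lam x : ℂ)))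
      = ((-2 / Complex.normSq (g x - (lam x : ℂ)) : ℝ) : ℂ) := by
    intro x
    push_cast
    rw [Complex.normSq_eq_conj_mul_self, map_sub, Complex.conj_ofReal, mul_comm]
  simp only [h2] at h1
  rw [intervalIntegral.integral_ofReal, ← Complex.ofReal_exp, Complex.sub_conj,
    Complex.sub_conj] at h1
  have h3 := congrArg Complex.im h1
  simp only [Complex.mul_im, Complex.mul_re, Complex.ofReal_re, Complex.ofReal_im, Complex.I_re,
    Complex.I_im, mul_zero, mul_one, add_zero] at h3
  linarith

theorem IsLoewnerSolution.mem_upperHalf {lam : ℝ → ℝ} {z : ℂ} {t : ℝ} {g : ℝ → ℂ}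
    (hlam : ContinuousOn lam (Icc 0 t)) (h : IsLoewnerSolution lam z t g) (hz : z ∈ upperHalf)
    {s : ℝ} (hs : s ∈ Icc 0 t) : g s ∈ upperHalf := by
  change 0 < (g s).im
  rw [h.im_eq hlam hs]
  exact mul_pos hz (Real.exp_pos _)

theorem IsLoewnerSolution.mem_upperHalf_of_mem {lam : ℝ → ℝ} {z : ℂ} {t : ℝ} {g : ℝ → ℂ}
    (hlam : ContinuousOn lam (Icc 0 t)) (h : IsLoewnerSolution lam z t g)
    {s : ℝ} (hs : s ∈ Icc 0 t) (hz : g s ∈ upperHalf) : z ∈ upperHalf := by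
  have hz' : 0 < (g s).im := hz
  rw [h.im_eq hlam hs] at hz'
  exact pos_of_mul_pos_left hz' (Real.exp_pos _).le

theorem antitoneOn_im_of_hasDerivWithinAt {g : ℝ → ℂ} {v : ℝ → ℂ} {t : ℝ}
    (h : ∀ s ∈ Icc (0 : ℝ) t, HasDerivWithinAt g (v s) (Icc 0 t) s)
    (hv : ∀ s ∈ Icc (0 : ℝ) t, (v s).im ≤ 0) : AntitoneOn (fun s => (g s).im) (Icc 0 t) := by
  refine antitoneOn_of_hasDerivWithinAt_nonpos (convex_Icc 0 t) (f' := fun s => (v s).im)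
    (fun s hs => Complex.continuous_im.continuousAt.comp_continuousWithinAt
      (h s hs).continuousWithinAt) (fun s hs => ?_) (fun s hs => hv s (interior_subset hs))
  exact (Complex.imCLM.hasFDerivAt.comp_hasDerivWithinAt s (h s (interior_subset hs))).mono
    interior_subset

theorem two_div_im_nonpos {w : ℂ} (hw : 0 ≤ w.im) : (2 / w).im ≤ 0 := by
  rw [Complex.div_im]
  simp only [Complex.im_ofNat, zero_mul, zero_div, Complex.re_ofNat, zero_sub, neg_nonpos]
  exact div_nonneg (mul_nonneg zero_le_two hw) (Complex.normSq_nonneg _)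

theorem IsLoewnerSolution.im_le {lam : ℝ → ℝ} {z : ℂ} {t : ℝ} {g : ℝ → ℂ}
    (hlam : ContinuousOn lam (Icc 0 t)) (h : IsLoewnerSolution lam z t g) (hz : z ∈ upperHalf)
    {s : ℝ} (hs : s ∈ Icc 0 t) : (g t).im ≤ (g s).im := by
  refine antitoneOn_im_of_hasDerivWithinAt (fun s hs => (h.2 s hs).2) (fun s hs => ?_) hs
    ⟨hs.1.trans hs.2, le_rfl⟩ hs.2
  apply two_div_im_nonpos
  simpa using (h.mem_upperHalf hlam hz hs).le

/-! ### The backward flow and the inverse flow map. -/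

/-- The point of the half-plane `y ≤ im` with the same real part, nearest to `w`. -/
noncomputable def imClip (y : ℝ) (w : ℂ) : ℂ := ⟨w.re, max w.im y⟩

theorem norm_imClip_sub_le (y : ℝ) (v w : ℂ) : ‖imClip y v - imClip y w‖ ≤ ‖v - w‖ := by
  rw [← sq_le_sq₀ (norm_nonneg _) (norm_nonneg _), Complex.sq_norm, Complex.sq_norm,
    Complex.normSq_apply, Complex.normSq_apply]
  have := sq_le_sq.2 (abs_max_sub_max_le_abs v.im w.im y)
  simp only [imClip, Complex.sub_re, Complex.sub_im]
  nlinarith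

theorem le_norm_imClip_sub (y : ℝ) (w : ℂ) (x : ℝ) : y ≤ ‖imClip y w - (x : ℂ)‖ :=
  (le_max_right _ _).trans (im_le_norm_sub_ofReal (imClip y w) x)

theorem norm_two_div_sub_two_div_le {a b : ℂ} {y : ℝ} (hy : 0 < y) (ha : y ≤ ‖a‖) (hb : y ≤ ‖b‖) :
    ‖2 / a - 2 / b‖ ≤ 2 / y ^ 2 * ‖a - b‖ := by
  have ha0 : a ≠ 0 := norm_pos_iff.1 (hy.trans_le ha)
  have hb0 : b ≠ 0 := norm_pos_iff.1 (hy.trans_le hb)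
  have h1 : 2 / a - 2 / b = 2 / (a * b) * (b - a) := by field_simp
  rw [h1, norm_mul, norm_sub_rev b a]
  gcongr
  rw [norm_div, norm_mul, Complex.norm_ofNat, sq]
  gcongr

/-- The Loewner equation can be solved backwards from any point of the upper half-plane. -/
theorem exists_isLoewnerSolution_terminal {lam : ℝ → ℝ} {t : ℝ} (ht : 0 ≤ t)
    (hlam : ContinuousOn lam (Icc 0 t)) {w : ℂ} (hw : w ∈ upperHalf) :
    ∃ g, IsLoewnerSolution lam (g 0) t g ∧ g t = w := by
  have hy : 0 < w.im := hw
  set y := w.im with hydef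
  -- Clipping at the height of the endpoint makes the field bounded and globally Lipschitz.
  -- Imaginary parts grow backwards in time, so the clip never acts on the solution obtained.
  let v : ℝ → ℂ → ℂ := fun s x => 2 / (imClip y x - (lam s : ℂ))
  have hP : IsPicardLindelof v (⟨t, ht, le_rfl⟩ : Icc (0 : ℝ) t) w
      (Real.toNNReal (2 / y * t)) 0 (Real.toNNReal (2 / y)) (Real.toNNReal (2 / y ^ 2)) := by
    refine ⟨fun s _ => ?_, fun x _ => ?_, fun s _ x _ => ?_, ?_⟩
    · refine LipschitzWith.lipschitzOnWith (LipschitzWith.of_dist_le_mul fun a b => ?_)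
      rw [Real.coe_toNNReal _ (by positivity), dist_eq_norm, dist_eq_norm]
      refine (norm_two_div_sub_two_div_le hy (le_norm_imClip_sub y a _)
        (le_norm_imClip_sub y b _)).trans ?_
      rw [sub_sub_sub_cancel_right]
      gcongr
      exact norm_imClip_sub_le y a b
    · refine continuousOn_const.div
        (continuousOn_const.sub (Complex.continuous_ofReal.comp_continuousOn hlam)) fun s _ => ?_
      exact norm_pos_iff.1 (hy.trans_le (le_norm_imClip_sub y x _))
    · rw [Real.coe_toNNReal _ (by positivity), norm_div, Complex.norm_ofNat]
      gcongr
      exact le_norm_imClip_sub y x _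
    · rw [Real.coe_toNNReal _ (by positivity), Real.coe_toNNReal _ (by positivity)]
      simp [ht]
  obtain ⟨g, hgt, hg⟩ := hP.exists_eq_forall_mem_Icc_hasDerivWithinAt₀
  simp only at hgt
  have him : ∀ s ∈ Icc (0 : ℝ) t, y ≤ (g s).im := by
    intro s hs
    have := antitoneOn_im_of_hasDerivWithinAt hg (fun s _ => two_div_im_nonpos (by
      simpa [imClip] using Or.inr hy.le)) hs ⟨ht, le_rfl⟩ hs.2
    simpa [hgt] using this
  refine ⟨g, ⟨rfl, fun s hs => ⟨?_, ?_⟩⟩, hgt⟩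
  · exact sub_ne_zero.1 (sub_ofReal_ne_zero_of_mem_upperHalf (hy.trans_le (him s hs)) _)
  · refine (hg s hs).congr_deriv ?_
    have : imClip y (g s) = g s := by
      apply Complex.ext <;> simp [imClip, him s hs]
    simp only [v, this]

open Classical in
/-- The solution on `[0, t]` of the Loewner equation that ends at `w`. -/
noncomputable def loewnerPath (lam : ℝ → ℝ) (t : ℝ) (w : ℂ) : ℝ → ℂ :=
  if h : ∃ g, IsLoewnerSolution lam (g 0) t g ∧ g t = w then h.choose else 0

/-- The inverse of the Loewner flow map. -/
noncomputable def loewnerInv (lam : ℝ → ℝ) (t : ℝ) (w : ℂ) : ℂ := loewnerPath lam t w 0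

theorem isLoewnerSolution_loewnerPath {lam : ℝ → ℝ} {t : ℝ} (ht : 0 ≤ t)
    (hlam : ContinuousOn lam (Icc 0 t)) {w : ℂ} (hw : w ∈ upperHalf) :
    IsLoewnerSolution lam (loewnerInv lam t w) t (loewnerPath lam t w) := by
  have h := exists_isLoewnerSolution_terminal ht hlam hw
  have := h.choose_spec.1
  rwa [loewnerInv, loewnerPath, dif_pos h]

theorem loewnerPath_terminal {lam : ℝ → ℝ} {t : ℝ} (ht : 0 ≤ t)
    (hlam : ContinuousOn lam (Icc 0 t)) {w : ℂ} (hw : w ∈ upperHalf) :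
    loewnerPath lam t w t = w := by
  have h := exists_isLoewnerSolution_terminal ht hlam hw
  rw [loewnerPath, dif_pos h]
  exact h.choose_spec.2

theorem loewnerInv_mem {lam : ℝ → ℝ} {t : ℝ} (ht : 0 ≤ t) (hlam : ContinuousOn lam (Icc 0 t))
    {w : ℂ} (hw : w ∈ upperHalf) : loewnerInv lam t w ∈ upperHalf \ loewnerHull lam t := by
  have h := isLoewnerSolution_loewnerPath ht hlam hw
  refine ⟨h.mem_upperHalf_of_mem hlam (right_mem_Icc.2 ht) ?_, fun h' => h'.2 ⟨_, h⟩⟩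
  rwa [loewnerPath_terminal ht hlam hw]

theorem IsLoewnerSolution.loewnerMap_eq {lam : ℝ → ℝ} {t : ℝ} {z : ℂ} {g : ℝ → ℂ} (ht : 0 ≤ t)
    (hlam : ContinuousOn lam (Icc 0 t)) (h : IsLoewnerSolution lam z t g) :
    loewnerMap lam t z = g t := by
  have h' : ∃ g, IsLoewnerSolution lam z t g := ⟨g, h⟩
  rw [loewnerMap, dif_pos h']
  exact h'.choose_spec.eqOn hlam h (right_mem_Icc.2 ht)

theorem IsLoewnerSolution.loewnerInv_eq {lam : ℝ → ℝ} {t : ℝ} {z : ℂ} {g : ℝ → ℂ} (ht : 0 ≤ t)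
    (hlam : ContinuousOn lam (Icc 0 t)) (h : IsLoewnerSolution lam z t g) (hz : z ∈ upperHalf) :
    loewnerInv lam t (g t) = z := by
  have hg := h.mem_upperHalf hlam hz (right_mem_Icc.2 ht)
  exact (isLoewnerSolution_loewnerPath ht hlam hg).initial_eq hlam h (right_mem_Icc.2 ht)
    (loewnerPath_terminal ht hlam hg)

theorem loewnerMap_loewnerInv {lam : ℝ → ℝ} {t : ℝ} (ht : 0 ≤ t)
    (hlam : ContinuousOn lam (Icc 0 t)) {w : ℂ} (hw : w ∈ upperHalf) :
    loewnerMap lam t (loewnerInv lam t w) = w := by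
  rw [(isLoewnerSolution_loewnerPath ht hlam hw).loewnerMap_eq ht hlam,
    loewnerPath_terminal ht hlam hw]

theorem exists_isLoewnerSolution_of_mem {lam : ℝ → ℝ} {t : ℝ} {z : ℂ}
    (hz : z ∈ upperHalf \ loewnerHull lam t) : ∃ g, IsLoewnerSolution lam z t g := by
  by_contra h
  exact hz.2 ⟨hz.1, h⟩

theorem loewnerMap_mem {lam : ℝ → ℝ} {t : ℝ} (ht : 0 ≤ t) (hlam : ContinuousOn lam (Icc 0 t))
    {z : ℂ} (hz : z ∈ upperHalf \ loewnerHull lam t) : loewnerMap lam t z ∈ upperHalf := by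
  obtain ⟨g, hg⟩ := exists_isLoewnerSolution_of_mem hz
  rw [hg.loewnerMap_eq ht hlam]
  exact hg.mem_upperHalf hlam hz.1 (right_mem_Icc.2 ht)

theorem loewnerInv_loewnerMap {lam : ℝ → ℝ} {t : ℝ} (ht : 0 ≤ t)
    (hlam : ContinuousOn lam (Icc 0 t)) {z : ℂ} (hz : z ∈ upperHalf \ loewnerHull lam t) :
    loewnerInv lam t (loewnerMap lam t z) = z := by
  obtain ⟨g, hg⟩ := exists_isLoewnerSolution_of_mem hz
  rw [hg.loewnerMap_eq ht hlam]
  exact hg.loewnerInv_eq ht hlam hz.1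

theorem loewnerInv_image {lam : ℝ → ℝ} {t : ℝ} (ht : 0 ≤ t) (hlam : ContinuousOn lam (Icc 0 t)) :
    loewnerInv lam t '' upperHalf = upperHalf \ loewnerHull lam t := by
  ext z
  constructor
  · rintro ⟨w, hw, rfl⟩
    exact loewnerInv_mem ht hlam hw
  · intro hz
    exact ⟨_, loewnerMap_mem ht hlam hz, loewnerInv_loewnerMap ht hlam hz⟩

theorem le_norm_loewnerPath_sub {lam : ℝ → ℝ} {t : ℝ} (ht : 0 ≤ t)
    (hlam : ContinuousOn lam (Icc 0 t)) {w : ℂ} (hw : w ∈ upperHalf) {s : ℝ} (hs : s ∈ Icc 0 t) :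
    w.im ≤ ‖loewnerPath lam t w s - (lam s : ℂ)‖ := by
  have h := isLoewnerSolution_loewnerPath ht hlam hw
  have h1 := h.im_le hlam (loewnerInv_mem ht hlam hw).1 hs
  rw [loewnerPath_terminal ht hlam hw] at h1
  exact h1.trans (im_le_norm_sub_ofReal _ _)

theorem norm_integral_le_of_norm_le_Icc {a : ℝ → ℂ} {C t s : ℝ} (hC : 0 ≤ C)
    (h : ∀ x ∈ Icc (0 : ℝ) t, ‖a x‖ ≤ C) (hs : s ∈ Icc 0 t) : ‖∫ x in (0 : ℝ)..s, a x‖ ≤ C * t := by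
  have := intervalIntegral.norm_integral_le_of_norm_le_const (a := 0) (b := s) (f := a) (C := C)
    (fun x hx => by
      rw [uIoc_of_le hs.1] at hx
      exact h x ⟨hx.1.le, hx.2.trans hs.2⟩)
  refine this.trans ?_
  rw [sub_zero, abs_of_nonneg hs.1]
  exact mul_le_mul_of_nonneg_left hs.2 hC

/-- The inverse flow map is holomorphic, with nonvanishing derivative. -/
theorem exists_hasDerivAt_loewnerInv {lam : ℝ → ℝ} {t : ℝ} (ht : 0 ≤ t)
    (hlam : ContinuousOn lam (Icc 0 t)) {w₀ : ℂ} (hw₀ : w₀ ∈ upperHalf) :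
    ∃ c, c ≠ 0 ∧ HasDerivAt (loewnerInv lam t) c w₀ := by
  have hy0 : 0 < w₀.im := hw₀
  -- Half the height leaves a neighbourhood of `w₀` in which every path keeps distance at least `y`
  -- from the driving term.
  obtain ⟨y, hydef⟩ : ∃ y, y = w₀.im / 2 := ⟨_, rfl⟩
  have hy : 0 < y := by rw [hydef]; positivity
  have hyw₀ : y ≤ w₀.im := by linarith
  set G := loewnerPath lam t
  let a : ℂ → ℝ → ℂ := fun w x => -2 / ((G w x - (lam x : ℂ)) * (G w₀ x - (lam x : ℂ)))
  let J : ℂ → ℝ → ℂ := fun w s => ∫ x in (0 : ℝ)..s, a w x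
  have hmem : ∀ w : ℂ, y ≤ w.im → w ∈ upperHalf := fun w hw => hy.trans_le hw
  have htt : t ∈ Icc 0 t := right_mem_Icc.2 ht
  have hlow : ∀ w : ℂ, y ≤ w.im → ∀ s ∈ Icc 0 t, y ≤ ‖G w s - (lam s : ℂ)‖ := fun w hw s hs =>
    hw.trans (le_norm_loewnerPath_sub ht hlam (hmem w hw) hs)
  have ha : ∀ w : ℂ, y ≤ w.im → ∀ s ∈ Icc 0 t, ‖a w s‖ ≤ 2 / y ^ 2 := by
    intro w hw s hs
    simp only [a]
    rw [norm_div, norm_neg, norm_mul, Complex.norm_ofNat, sq]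
    have := hlow w hw s hs
    have := hlow w₀ hyw₀ s hs
    gcongr
  have hJ : ∀ w : ℂ, y ≤ w.im → ∀ s ∈ Icc 0 t, ‖J w s‖ ≤ 2 / y ^ 2 * t := fun w hw s hs =>
    norm_integral_le_of_norm_le_Icc (by positivity) (ha w hw) hs
  have hsol : ∀ w : ℂ, y ≤ w.im → IsLoewnerSolution lam (loewnerInv lam t w) t (G w) :=
    fun w hw => isLoewnerSolution_loewnerPath ht hlam (hmem w hw)
  have hdiff : ∀ w : ℂ, y ≤ w.im → ∀ s ∈ Icc 0 t,
      G w s - G w₀ s = (loewnerInv lam t w - loewnerInv lam t w₀) * Complex.exp (J w s) :=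
    fun w hw s hs => (hsol w hw).sub_eq hlam (hsol w₀ hyw₀) hs
  -- At the final time the difference formula says that the difference quotient of the inverse map
  -- is exactly `exp (-J w t)`. It only remains to see that `J` is continuous in `w`.
  have hinv : ∀ w : ℂ, y ≤ w.im →
      loewnerInv lam t w - loewnerInv lam t w₀ = (w - w₀) * Complex.exp (-J w t) := by
    intro w hw
    have h1 := hdiff w hw t htt
    have e1 : G w t = w := loewnerPath_terminal ht hlam (hmem w hw)
    have e2 : G w₀ t = w₀ := loewnerPath_terminal ht hlam hw₀
    rw [e1, e2] at h1
    rw [h1, mul_assoc, ← Complex.exp_add, add_neg_cancel, Complex.exp_zero, mul_one]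
  obtain ⟨C, hCdef⟩ : ∃ C, C = Real.exp (2 / y ^ 2 * t + 2 / y ^ 2 * t) := ⟨_, rfl⟩
  have hclose : ∀ w : ℂ, y ≤ w.im → ∀ s ∈ Icc 0 t, ‖G w s - G w₀ s‖ ≤ ‖w - w₀‖ * C := by
    intro w hw s hs
    rw [hdiff w hw s hs, hinv w hw, mul_assoc, ← Complex.exp_add, norm_mul, hCdef]
    gcongr
    refine (Complex.norm_exp_le_exp_norm _).trans (Real.exp_le_exp.2 ((norm_add_le _ _).trans ?_))
    rw [norm_neg]
    exact add_le_add (hJ w hw t htt) (hJ w hw s hs)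
  have hadiff : ∀ w : ℂ, y ≤ w.im → ∀ s ∈ Icc 0 t,
      ‖a w s - a w₀ s‖ ≤ 2 / y ^ 2 * (‖w - w₀‖ * C) * (1 / y) := by
    intro w hw s hs
    have e : a w s - a w₀ s = -(2 / (G w s - (lam s : ℂ)) - 2 / (G w₀ s - (lam s : ℂ)))
        * (1 / (G w₀ s - (lam s : ℂ))) := by
      have h1 := (hsol w hw).sub_ne_zero hs
      have h2 := (hsol w₀ hyw₀).sub_ne_zero hs
      simp only [a]
      field_simp
      ring
    rw [e, norm_mul, norm_neg, norm_div, norm_one]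
    have h1 := hlow w hw s hs
    have h2 := hlow w₀ hyw₀ s hs
    have h3 := norm_two_div_sub_two_div_le hy h1 h2
    rw [sub_sub_sub_cancel_right] at h3
    have h4 := hclose w hw s hs
    exact mul_le_mul (h3.trans (mul_le_mul_of_nonneg_left h4 (by positivity)))
      (one_div_le_one_div_of_le hy h2) (by positivity) (by rw [hCdef]; positivity)
  have hnear : ∀ᶠ w in 𝓝 w₀, y ≤ w.im := by
    filter_upwards [Complex.continuous_im.continuousAt.eventually (lt_mem_nhds (by linarith :
      y < w₀.im))] with w hw using hw.le
  have hJcont : Tendsto (fun w => J w t) (𝓝 w₀) (𝓝 (J w₀ t)) := by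
    rw [tendsto_iff_norm_sub_tendsto_zero]
    refine squeeze_zero' (Eventually.of_forall fun _ => norm_nonneg _)
      (g := fun w => 2 / y ^ 2 * (‖w - w₀‖ * C) * (1 / y) * t) ?_ ?_
    · filter_upwards [hnear] with w hw
      have hi : ∀ w : ℂ, y ≤ w.im → IntervalIntegrable (a w) MeasureTheory.volume 0 t :=
        fun w hw => ContinuousOn.intervalIntegrable (by
          rw [uIcc_of_le ht]
          exact (hsol w hw).continuousOn_coeff hlam (hsol w₀ hyw₀))
      simp only [J]
      rw [← intervalIntegral.integral_sub (hi w hw) (hi w₀ hyw₀)]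
      exact norm_integral_le_of_norm_le_Icc (by rw [hCdef]; positivity) (hadiff w hw) htt
    · have : ContinuousAt (fun w => 2 / y ^ 2 * (‖w - w₀‖ * C) * (1 / y) * t) w₀ := by fun_prop
      simpa [ContinuousAt] using this
  refine ⟨Complex.exp (-J w₀ t), Complex.exp_ne_zero _, ?_⟩
  rw [hasDerivAt_iff_tendsto_slope]
  refine Tendsto.congr' ?_ ((hJcont.neg.cexp).mono_left nhdsWithin_le_nhds)
  filter_upwards [hnear.filter_mono nhdsWithin_le_nhds, self_mem_nhdsWithin] with w hw hne
  rw [slope_def_field, hinv w hw, mul_div_cancel_left₀ _ (sub_ne_zero.2 hne)]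

theorem differentiableOn_loewnerInv {lam : ℝ → ℝ} {t : ℝ} (ht : 0 ≤ t)
    (hlam : ContinuousOn lam (Icc 0 t)) : DifferentiableOn ℂ (loewnerInv lam t) upperHalf := by
  intro w hw
  obtain ⟨c, -, hc⟩ := exists_hasDerivAt_loewnerInv ht hlam hw
  exact hc.differentiableAt.differentiableWithinAt

/-- The flow map is a local inverse of a holomorphic function with nonzero derivative. -/
theorem differentiableOn_loewnerMap {lam : ℝ → ℝ} {t : ℝ} (ht : 0 ≤ t)
    (hlam : ContinuousOn lam (Icc 0 t)) :
    DifferentiableOn ℂ (loewnerMap lam t) (upperHalf \ loewnerHull lam t) := by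
  intro z hz
  have hw := loewnerMap_mem ht hlam hz
  have hfz := loewnerInv_loewnerMap ht hlam hz
  obtain ⟨c, hc0, hc⟩ := exists_hasDerivAt_loewnerInv ht hlam hw
  have han : AnalyticAt ℂ (loewnerInv lam t) (loewnerMap lam t z) :=
    (differentiableOn_loewnerInv ht hlam).analyticAt (isOpen_upperHalf.mem_nhds hw)
  have hstrict : HasStrictDerivAt (loewnerInv lam t) c (loewnerMap lam t z) := by
    have := han.hasStrictDerivAt
    rwa [hc.deriv] at this
  have hleft : ∀ᶠ x in 𝓝 (loewnerMap lam t z), loewnerMap lam t (loewnerInv lam t x) = x := by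
    filter_upwards [isOpen_upperHalf.mem_nhds hw] with x hx using loewnerMap_loewnerInv ht hlam hx
  have := hstrict.to_local_left_inverse hc0 hleft
  rw [hfz] at this
  exact this.hasDerivAt.differentiableAt.differentiableWithinAt

theorem IsLoewnerSolution.mono {lam : ℝ → ℝ} {z : ℂ} {s t : ℝ} {g : ℝ → ℂ}
    (h : IsLoewnerSolution lam z t g) (hst : s ≤ t) : IsLoewnerSolution lam z s g :=
  ⟨h.1, fun x hx => ⟨(h.2 x ⟨hx.1, hx.2.trans hst⟩).1,
    (h.2 x ⟨hx.1, hx.2.trans hst⟩).2.mono (Icc_subset_Icc_right hst)⟩⟩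

/-! ### Behaviour near infinity and half-plane capacity. -/

/-- A curve with velocity at most `2 / |G - m|`, `m` bounded, that starts far away hardly moves. -/
theorem norm_sub_le_of_speed_le {G v : ℝ → ℂ} {m : ℝ → ℝ} {t M R : ℝ} (hR : 0 < R)
    (hG : ∀ s ∈ Icc (0 : ℝ) t, HasDerivWithinAt G (v s) (Icc 0 t) s)
    (hv : ∀ s ∈ Icc (0 : ℝ) t, ‖v s‖ ≤ 2 / ‖G s - (m s : ℂ)‖)
    (hm : ∀ s ∈ Icc (0 : ℝ) t, |m s| ≤ M) (h0 : M + R + 3 / R * t ≤ ‖G 0‖) :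
    ∀ s ∈ Icc (0 : ℝ) t, ‖G s - G 0‖ ≤ 3 / R * t := by
  intro s hs
  -- While the displacement is within the barrier, the curve is at distance at least `R` from `m`
  -- and its speed is at most `2 / R`. The slope `3 / R` supplies the strict inequality that the
  -- comparison requires.
  have key := image_norm_le_of_norm_deriv_right_lt_deriv_boundary (f := fun s => G s - G 0)
    (f' := v) (a := 0) (b := t) (B := fun s => 3 / R * s) (B' := fun _ => 3 / R)
    (fun s hs => ((hG s hs).sub_const _).continuousWithinAt)
    (fun s hs => ((hG s (Ico_subset_Icc_self hs)).sub_const _).mono_of_mem_nhdsWithin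
      (Icc_mem_nhdsGE_of_mem hs)) (by simp)
    (fun x => by simpa using (hasDerivAt_id x).const_mul (3 / R)) (fun s hs hb => by
      have hs' := Ico_subset_Icc_self hs
      have h1 : 3 / R * s ≤ 3 / R * t := mul_le_mul_of_nonneg_left hs'.2 (by positivity)
      have h2 : R ≤ ‖G s - (m s : ℂ)‖ := by
        have h3 : G 0 = (G s - (m s : ℂ)) + (m s : ℂ) - (G s - G 0) := by ring
        have h4 := norm_sub_le ((G s - (m s : ℂ)) + (m s : ℂ)) (G s - G 0)
        have h5 := norm_add_le (G s - (m s : ℂ)) (m s : ℂ)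
        rw [← h3] at h4
        rw [Complex.norm_real, Real.norm_eq_abs] at h5
        have h6 := hm s hs'
        linarith
      calc ‖v s‖ ≤ 2 / ‖G s - (m s : ℂ)‖ := hv s hs'
        _ ≤ 2 / R := by gcongr
        _ < 3 / R := by gcongr; norm_num) hs
  exact key.trans (mul_le_mul_of_nonneg_left hs.2 (by positivity))

theorem exists_abs_le_of_continuousOn {lam : ℝ → ℝ} {t : ℝ} (hlam : ContinuousOn lam (Icc 0 t)) :
    ∃ M, 0 ≤ M ∧ ∀ s ∈ Icc (0 : ℝ) t, |lam s| ≤ M := by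
  obtain ⟨M, hM⟩ := isCompact_Icc.exists_bound_of_continuousOn hlam
  exact ⟨max M 0, le_max_right _ _, fun s hs => (hM s hs).trans (le_max_left _ _)⟩

/-- Solutions of the Loewner equation that start or end far away hardly move. -/
theorem exists_forall_norm_sub_le {lam : ℝ → ℝ} {t : ℝ} (ht : 0 ≤ t)
    (hlam : ContinuousOn lam (Icc 0 t)) {ε : ℝ} (hε : 0 < ε) :
    ∃ R, ∀ z g, IsLoewnerSolution lam z t g → R ≤ ‖z‖ ∨ R ≤ ‖g t‖ →
      ∀ s ∈ Icc (0 : ℝ) t, ‖g s - z‖ ≤ ε := by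
  obtain ⟨M, hM0, hM⟩ := exists_abs_le_of_continuousOn hlam
  obtain ⟨R, hR, hRε⟩ : ∃ R : ℝ, 0 < R ∧ 3 / R * t ≤ ε / 2 := by
    refine ⟨6 * (t + 1) / ε, by positivity, ?_⟩
    have : 3 / (6 * (t + 1) / ε) * t = ε / 2 * (t / (t + 1)) := by field_simp; ring
    rw [this]
    exact mul_le_of_le_one_right (by positivity) ((div_le_one (by positivity)).2 (by linarith))
  refine ⟨M + R + 3 / R * t, fun z g hg h s hs => ?_⟩
  rcases h with h | h
  · have := norm_sub_le_of_speed_le hR (fun s hs => (hg.2 s hs).2)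
      (fun s _ => by rw [norm_div, Complex.norm_ofNat]) hM (by rwa [hg.1]) s hs
    rw [hg.1] at this
    linarith
  -- Time reversal turns a far endpoint into a far starting point. The displacement from `z` is then
  -- a difference of two displacements from `g t`, which is why `R` was chosen for `ε / 2`.
  · have hrev : ∀ s ∈ Icc (0 : ℝ) t, t - s ∈ Icc (0 : ℝ) t := fun s hs =>
      ⟨sub_nonneg.2 hs.2, sub_le_self _ hs.1⟩
    have key := norm_sub_le_of_speed_le (G := fun s => g (t - s))
      (v := fun s => (-1 : ℝ) • (2 / (g (t - s) - (lam (t - s) : ℂ))))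
      (m := fun s => lam (t - s)) hR
      (fun s hs => (hg.2 (t - s) (hrev s hs)).2.scomp s
        (((hasDerivAt_id s).const_sub t).hasDerivWithinAt) hrev)
      (fun s _ => by rw [neg_one_smul, norm_neg, norm_div, Complex.norm_ofNat])
      (fun s hs => hM _ (hrev s hs)) (by simpa using h)
    have h1 := key (t - s) (hrev s hs)
    have h2 := key t ⟨ht, le_rfl⟩
    simp only [sub_sub_cancel, sub_zero, sub_self] at h1 h2
    rw [hg.1] at h2
    have h3 : g s - z = (g s - g t) - (z - g t) := by ring
    rw [h3]
    have := norm_sub_le (g s - g t) (z - g t)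
    linarith

theorem exists_forall_norm_loewnerInv_sub_le {lam : ℝ → ℝ} {t : ℝ} (ht : 0 ≤ t)
    (hlam : ContinuousOn lam (Icc 0 t)) {ε : ℝ} (hε : 0 < ε) :
    ∃ R, ∀ w ∈ upperHalf, R ≤ ‖w‖ → ‖loewnerInv lam t w - w‖ ≤ ε := by
  obtain ⟨R, hR⟩ := exists_forall_norm_sub_le ht hlam hε
  refine ⟨R, fun w hw hwR => ?_⟩
  have h := loewnerPath_terminal ht hlam hw
  have := hR _ _ (isLoewnerSolution_loewnerPath ht hlam hw) (Or.inr (by rwa [h])) t ⟨ht, le_rfl⟩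
  rwa [h, norm_sub_rev] at this

theorem exists_forall_norm_loewnerMap_sub_le {lam : ℝ → ℝ} {t : ℝ} (ht : 0 ≤ t)
    (hlam : ContinuousOn lam (Icc 0 t)) {ε : ℝ} (hε : 0 < ε) :
    ∃ R, ∀ z ∈ upperHalf \ loewnerHull lam t, R ≤ ‖z‖ → ‖loewnerMap lam t z - z‖ ≤ ε := by
  obtain ⟨R, hR⟩ := exists_forall_norm_sub_le ht hlam hε
  refine ⟨R, fun z hz hzR => ?_⟩
  obtain ⟨g, hg⟩ := exists_isLoewnerSolution_of_mem hz
  rw [hg.loewnerMap_eq ht hlam]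
  exact hR z g hg (Or.inl hzR) t ⟨ht, le_rfl⟩

/-- The half-plane capacity of the hull at time `t` is `2 t`. -/
theorem exists_forall_norm_capacity_sub_le {lam : ℝ → ℝ} {t : ℝ} (ht : 0 ≤ t)
    (hlam : ContinuousOn lam (Icc 0 t)) {ε : ℝ} (hε : 0 < ε) :
    ∃ R, ∀ w ∈ upperHalf, R ≤ ‖w‖ → ‖(w - loewnerInv lam t w) * w - 2 * t‖ ≤ ε := by
  obtain ⟨M, hM0, hM⟩ := exists_abs_le_of_continuousOn hlam
  obtain ⟨R, hR⟩ := exists_forall_norm_sub_le ht hlam one_pos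
  obtain ⟨η, hη, hηt⟩ : ∃ η : ℝ, 0 < η ∧ η * t ≤ ε := by
    refine ⟨ε / (t + 1), by positivity, ?_⟩
    rw [div_mul_eq_mul_div]
    exact (div_le_iff₀ (by positivity)).2 (by nlinarith)
  refine ⟨max R (2 + M + 2 * (2 + M) / η), fun w hw hwR => ?_⟩
  have hg := isLoewnerSolution_loewnerPath ht hlam hw
  have hgt := loewnerPath_terminal ht hlam hw
  set g := loewnerPath lam t w
  set z := loewnerInv lam t w
  have hclose := hR z g hg (Or.inr (by rw [hgt]; exact (le_max_left _ _).trans hwR))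
  have hw2 : 2 + M + 2 * (2 + M) / η ≤ ‖w‖ := (le_max_right _ _).trans hwR
  have hpos : 0 < 2 * (2 + M) / η := by positivity
  have hwz := hclose t ⟨ht, le_rfl⟩
  rw [hgt] at hwz
  -- The quantity `g s * w - 2 s` has derivative `2 w / (g s - lam s) - 2`, which is small because
  -- `g s` stays within bounded distance of the large point `w`.
  have key := norm_image_sub_le_of_norm_deriv_le_segment' (f := fun s : ℝ => g s * w - 2 * (s : ℂ))
    (f' := fun s => 2 / (g s - (lam s : ℂ)) * w - 2) (a := 0) (b := t) (C := η) (fun s hs => by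
      refine ((hg.2 s hs).2.mul_const w).sub ?_
      simpa using ((Complex.ofRealCLM.hasDerivAt (x := s)).const_mul (2 : ℂ)).hasDerivWithinAt)
    (fun s hs => by
      have hs' := Ico_subset_Icc_self hs
      have hne := hg.sub_ne_zero hs'
      have e : 2 / (g s - (lam s : ℂ)) * w - 2
          = 2 * ((w - z) - (g s - z) + (lam s : ℂ)) / (g s - (lam s : ℂ)) := by
        field_simp
        ring
      have h1 := hclose s hs'
      have h2 := hM s hs'
      have h3 : ‖(w - z) - (g s - z) + (lam s : ℂ)‖ ≤ 2 + M := by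
        have h4 := norm_add_le ((w - z) - (g s - z)) (lam s : ℂ)
        have h5 := norm_sub_le (w - z) (g s - z)
        rw [Complex.norm_real, Real.norm_eq_abs] at h4
        linarith
      have h6 : 2 * (2 + M) / η ≤ ‖g s - (lam s : ℂ)‖ := by
        have h7 := norm_add_le (g s - (lam s : ℂ)) ((w - z) - (g s - z) + (lam s : ℂ))
        have h8 : (g s - (lam s : ℂ)) + ((w - z) - (g s - z) + (lam s : ℂ)) = w := by ring
        rw [h8] at h7
        linarith
      rw [e, norm_div, norm_mul, Complex.norm_ofNat, div_le_iff₀ (hpos.trans_le h6)]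
      rw [div_le_iff₀ hη] at h6
      linarith) t ⟨ht, le_rfl⟩
  simp only [hgt, hg.1] at key
  have e : (w - z) * w - 2 * t = w * w - 2 * (t : ℂ) - (z * w - 2 * ((0 : ℝ) : ℂ)) := by
    push_cast
    ring
  rw [e]
  exact key.trans (by rwa [sub_zero])

/-! ### The hulls determine the flow map, the time and the driving term. -/

/-- A self-map of the upper half-plane that is asymptotic to the identity does not decrease the
imaginary part. -/
theorem im_le_im_of_asymptotic_id {φ : ℂ → ℂ} (hd : DifferentiableOn ℂ φ upperHalf)
    (hmaps : MapsTo φ upperHalf upperHalf)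
    (hφ : ∀ ε > 0, ∃ R, ∀ w ∈ upperHalf, R ≤ ‖w‖ → ‖φ w - w‖ ≤ ε) {w₀ : ℂ} (hw₀ : w₀ ∈ upperHalf) :
    w₀.im ≤ (φ w₀).im := by
  have main : ∀ ε > 0, ε < w₀.im → w₀.im - (φ w₀).im ≤ ε := by
    intro ε hε hεw
    obtain ⟨R, hR⟩ := hφ ε hε
    obtain ⟨R', hRR', hw₀R'⟩ : ∃ R', R ≤ R' ∧ ‖w₀‖ < R' :=
      ⟨max R (‖w₀‖ + 1), le_max_left _ _, by simp⟩
    -- The modulus of `ψ` is `exp (im w - im (φ w))`. On the line `im = ε` it is at most `exp ε`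
    -- because `φ w` has positive imaginary part, and on the large circle because `φ` is close to
    -- the identity; the maximum principle gives the rest.
    let ψ : ℂ → ℂ := fun w => Complex.exp (Complex.I * (φ w - w))
    have hψ : ∀ w, ‖ψ w‖ = Real.exp (w.im - (φ w).im) := by
      intro w
      simp [ψ, Complex.norm_exp]
    let U : Set ℂ := {w | ε < w.im} ∩ Metric.ball 0 R'
    have hUo : IsOpen U := (isOpen_lt continuous_const Complex.continuous_im).inter Metric.isOpen_ball
    have hclU : closure U ⊆ {w | ε ≤ w.im} :=
      closure_minimal (fun w hw => (show ε < w.im from hw.1).le)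
        (isClosed_le continuous_const Complex.continuous_im)
    have hsub : closure U ⊆ upperHalf := fun w hw => hε.trans_le (hclU hw)
    have hdψ : DifferentiableOn ℂ ψ (closure U) :=
      (((hd.mono hsub).sub differentiableOn_id).const_mul Complex.I).cexp
    have key := Complex.norm_le_of_forall_mem_frontier_norm_le (U := U)
      (Metric.isBounded_ball.subset inter_subset_right) hdψ.diffContOnCl (C := Real.exp ε)
      (fun w hw => by
        rw [hUo.frontier_eq] at hw
        have hwH := hsub hw.1
        have hpos : 0 < (φ w).im := hmaps hwH
        rw [hψ]
        apply Real.exp_le_exp.2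
        by_cases hwε : ε < w.im
        · have hwR : R' ≤ ‖w‖ := by
            by_contra! hlt
            exact hw.2 ⟨hwε, by simpa using hlt⟩
          have h1 := hR w hwH (hRR'.trans hwR)
          have h2 := (Complex.abs_im_le_norm (φ w - w)).trans h1
          rw [Complex.sub_im] at h2
          linarith [(abs_le.1 h2).1]
        · linarith [not_lt.1 hwε]) (subset_closure (show w₀ ∈ U from ⟨hεw, by simpa using hw₀R'⟩))
    rw [hψ] at key
    exact Real.exp_le_exp.1 key
  have h0 : 0 < w₀.im := hw₀
  refine le_of_forall_pos_le_add fun ε hε => ?_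
  have := main (min ε (w₀.im / 2)) (by positivity) ((min_le_right _ _).trans_lt (by linarith))
  linarith [min_le_left ε (w₀.im / 2)]

theorem exists_mem_upperHalf_norm_ge (R : ℝ) : ∃ w ∈ upperHalf, R ≤ ‖w‖ := by
  refine ⟨((max R 1 : ℝ) : ℂ) * Complex.I, ?_, ?_⟩
  · simp [upperHalf]
  · simp only [norm_mul, Complex.norm_real, Complex.norm_I, mul_one, Real.norm_eq_abs]
    exact (le_max_left _ _).trans (le_abs_self _)

/-- A conformal automorphism of the upper half-plane that is asymptotic to the identity is the
identity. -/
theorem eq_self_of_asymptotic_id {φ ψ : ℂ → ℂ} (hφd : DifferentiableOn ℂ φ upperHalf)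
    (hψd : DifferentiableOn ℂ ψ upperHalf) (hφm : MapsTo φ upperHalf upperHalf)
    (hψm : MapsTo ψ upperHalf upperHalf) (hψφ : ∀ w ∈ upperHalf, ψ (φ w) = w)
    (hφ : ∀ ε > 0, ∃ R, ∀ w ∈ upperHalf, R ≤ ‖w‖ → ‖φ w - w‖ ≤ ε)
    (hψ : ∀ ε > 0, ∃ R, ∀ w ∈ upperHalf, R ≤ ‖w‖ → ‖ψ w - w‖ ≤ ε) :
    ∀ w ∈ upperHalf, φ w = w := by
  -- Neither `φ` nor `ψ` decreases imaginary parts and `ψ` undoes `φ`, so `φ` preserves them and `φ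
  -- - id` is constant.
  obtain ⟨c, hc⟩ := AnalyticOnNhd.eq_const_of_im_eq_const (f := fun w => φ w - w) (c₀ := 0)
    (U := upperHalf) ((hφd.sub differentiableOn_id).analyticOnNhd isOpen_upperHalf)
    (fun w hw => by
      have h1 := im_le_im_of_asymptotic_id hφd hφm hφ hw
      have h2 := im_le_im_of_asymptotic_id hψd hψm hψ (hφm hw)
      rw [hψφ w hw] at h2
      rw [Complex.sub_im]
      linarith) isOpen_upperHalf isConnected_upperHalf
  have hc0 : c = 0 := by
    rw [← norm_le_zero_iff]
    refine le_of_forall_pos_le_add fun ε hε => ?_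
    obtain ⟨R, hR⟩ := hφ ε hε
    obtain ⟨w, hw, hwR⟩ := exists_mem_upperHalf_norm_ge R
    have := hR w hw hwR
    have h2 := hc w hw
    rwa [h2, ← zero_add ε] at this
  intro w hw
  rw [← sub_eq_zero, ← hc0]
  exact hc w hw

theorem exists_asymptotic_comp {lam mu : ℝ → ℝ} {t t' : ℝ} (ht : 0 ≤ t) (ht' : 0 ≤ t')
    (hlam : ContinuousOn lam (Icc 0 t)) (hmu : ContinuousOn mu (Icc 0 t'))
    (h : loewnerHull lam t = loewnerHull mu t') {ε : ℝ} (hε : 0 < ε) :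
    ∃ R, ∀ w ∈ upperHalf, R ≤ ‖w‖ → ‖loewnerMap mu t' (loewnerInv lam t w) - w‖ ≤ ε := by
  obtain ⟨R₁, hR₁⟩ := exists_forall_norm_loewnerInv_sub_le ht hlam (half_pos hε)
  obtain ⟨R₂, hR₂⟩ := exists_forall_norm_loewnerMap_sub_le ht' hmu (half_pos hε)
  -- The extra `ε / 2` absorbs the displacement by `loewnerInv`, so that the intermediate point
  -- still has norm at least `R₂`.
  refine ⟨max R₁ (R₂ + ε / 2), fun w hw hwR => ?_⟩
  have h1 := hR₁ w hw ((le_max_left _ _).trans hwR)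
  have hmem := loewnerInv_mem ht hlam hw
  rw [h] at hmem
  have h2 := hR₂ _ hmem (by
    have h3 := (le_max_right _ _).trans hwR
    have h4 := norm_sub_norm_le w (loewnerInv lam t w)
    rw [norm_sub_rev] at h4
    linarith)
  calc _ = ‖(loewnerMap mu t' (loewnerInv lam t w) - loewnerInv lam t w)
        + (loewnerInv lam t w - w)‖ := by rw [sub_add_sub_cancel]
    _ ≤ _ := (norm_add_le _ _).trans (by linarith)

/-- The hull determines the inverse flow map. -/
theorem loewnerInv_eq_of_loewnerHull_eq {lam mu : ℝ → ℝ} {t t' : ℝ} (ht : 0 ≤ t) (ht' : 0 ≤ t')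
    (hlam : ContinuousOn lam (Icc 0 t)) (hmu : ContinuousOn mu (Icc 0 t'))
    (h : loewnerHull lam t = loewnerHull mu t') {w : ℂ} (hw : w ∈ upperHalf) :
    loewnerInv lam t w = loewnerInv mu t' w := by
  have hm : ∀ w ∈ upperHalf, loewnerInv lam t w ∈ upperHalf \ loewnerHull mu t' :=
    fun w hw => h ▸ loewnerInv_mem ht hlam hw
  have hm' : ∀ w ∈ upperHalf, loewnerInv mu t' w ∈ upperHalf \ loewnerHull lam t :=
    fun w hw => h ▸ loewnerInv_mem ht' hmu hw
  have key := eq_self_of_asymptotic_id (φ := fun w => loewnerMap mu t' (loewnerInv lam t w))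
    (ψ := fun w => loewnerMap lam t (loewnerInv mu t' w))
    ((differentiableOn_loewnerMap ht' hmu).comp (differentiableOn_loewnerInv ht hlam) hm)
    ((differentiableOn_loewnerMap ht hlam).comp (differentiableOn_loewnerInv ht' hmu) hm')
    (fun w hw => loewnerMap_mem ht' hmu (hm w hw)) (fun w hw => loewnerMap_mem ht hlam (hm' w hw))
    (fun w hw => by
      rw [loewnerInv_loewnerMap ht' hmu (hm w hw), loewnerMap_loewnerInv ht hlam hw])
    (fun ε hε => exists_asymptotic_comp ht ht' hlam hmu h hε)
    (fun ε hε => exists_asymptotic_comp ht' ht hmu hlam h.symm hε) w hw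
  have h2 := loewnerInv_loewnerMap ht' hmu (hm w hw)
  rw [← h2]
  exact congrArg _ key

/-- The hull determines the time. -/
theorem time_eq_of_loewnerHull_eq {lam mu : ℝ → ℝ} {t t' : ℝ} (ht : 0 ≤ t) (ht' : 0 ≤ t')
    (hlam : ContinuousOn lam (Icc 0 t)) (hmu : ContinuousOn mu (Icc 0 t'))
    (h : loewnerHull lam t = loewnerHull mu t') : t = t' := by
  have : ‖(2 * t - 2 * t' : ℂ)‖ ≤ 0 := by
    refine le_of_forall_pos_le_add fun ε hε => ?_
    obtain ⟨R₁, hR₁⟩ := exists_forall_norm_capacity_sub_le ht hlam (half_pos hε)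
    obtain ⟨R₂, hR₂⟩ := exists_forall_norm_capacity_sub_le ht' hmu (half_pos hε)
    obtain ⟨w, hw, hwR⟩ := exists_mem_upperHalf_norm_ge (max R₁ R₂)
    have h1 := hR₁ w hw ((le_max_left _ _).trans hwR)
    have h2 := hR₂ w hw ((le_max_right _ _).trans hwR)
    rw [loewnerInv_eq_of_loewnerHull_eq ht ht' hlam hmu h hw] at h1
    have e : (2 * t - 2 * t' : ℂ) = ((w - loewnerInv mu t' w) * w - 2 * t')
        - ((w - loewnerInv mu t' w) * w - 2 * t) := by ring
    rw [e]
    exact (norm_sub_le _ _).trans (by linarith)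
  rw [norm_le_zero_iff, sub_eq_zero] at this
  exact_mod_cast mul_left_cancel₀ two_ne_zero this

/-- The hulls up to time `t` determine the driving term at time `t`. -/
theorem driving_eq_of_loewnerHull_eq {lam mu : ℝ → ℝ} {t : ℝ} (ht : 0 < t)
    (hlam : ContinuousOn lam (Icc 0 t)) (hmu : ContinuousOn mu (Icc 0 t))
    (h : ∀ s ∈ Icc 0 t, loewnerHull lam s = loewnerHull mu s) : lam t = mu t := by
  have hI : Complex.I ∈ upperHalf := by simp [upperHalf]
  have hg := isLoewnerSolution_loewnerPath ht.le hlam hI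
  have hz := loewnerInv_mem ht.le hlam hI
  set g₁ := loewnerPath lam t Complex.I
  set z := loewnerInv lam t Complex.I
  obtain ⟨g₂, hg₂⟩ := exists_isLoewnerSolution_of_mem (h t ⟨ht.le, le_rfl⟩ ▸ hz)
  -- At each time `s` both trajectories are the image of the same `z` under a map determined by the
  -- common hull. Equal trajectories have equal one-sided derivatives at `t`, from which the driving
  -- term is read off.
  have heq : EqOn g₁ g₂ (Icc 0 t) := by
    intro s hs
    have hl := hlam.mono (Icc_subset_Icc_right hs.2)
    have hm := hmu.mono (Icc_subset_Icc_right hs.2)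
    have h1 := hg.mono hs.2
    have h2 := hg₂.mono hs.2
    have e1 := h1.loewnerInv_eq hs.1 hl hz.1
    have hgs := h1.mem_upperHalf hl hz.1 (right_mem_Icc.2 hs.1)
    rw [loewnerInv_eq_of_loewnerHull_eq hs.1 hs.1 hl hm (h s hs) hgs] at e1
    rw [← h2.loewnerMap_eq hs.1 hm, ← e1, loewnerMap_loewnerInv hs.1 hm hgs]
  have htt : t ∈ Icc 0 t := right_mem_Icc.2 ht.le
  have hu := (uniqueDiffOn_Icc ht t htt).eq_deriv _ (hg.2 t htt).2
    ((hg₂.2 t htt).2.congr heq (heq htt))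
  rw [← heq htt] at hu
  have n1 := hg.sub_ne_zero htt
  have n2 := hg₂.sub_ne_zero htt
  rw [← heq htt] at n2
  rw [div_eq_div_iff n1 n2] at hu
  have := mul_left_cancel₀ two_ne_zero hu
  exact_mod_cast (sub_right_injective this).symm

/-! ### The explicit driving term and its regularity. -/

/-- The time at which the circular slit flow reaches the parameter `r`. -/
noncomputable def slitTime (r : ℝ) : ℝ := Real.pi ^ 2 / 6 * (4 * r ^ 3 - 3 * r ^ 4)

/-- The parameter of the circular slit flow at time `t`. -/
noncomputable def slitParam (t : ℝ) : ℝ := Function.invFunOn slitTime (Ico 0 1) t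

/-- The driving term of the circular slit. -/
noncomputable def slitDriving (t : ℝ) : ℝ := Real.pi * slitParam t * (2 - 3 * slitParam t)

/-- This is the source of the Hölder exponent `1/3`. With `d = b - a` and `e = 1 - b`, the excess
over `d ^ 3` of the increment of `4r³ - 3r⁴` is a polynomial in `a`, `d`, `e` with nonnegative
coefficients, and the prefactor `π²/6` is at least `1`. -/
theorem cube_sub_le_slitTime_sub {a b : ℝ} (ha : 0 ≤ a) (hab : a ≤ b) (hb : b ≤ 1) :
    (b - a) ^ 3 ≤ slitTime b - slitTime a := by
  obtain ⟨d, rfl⟩ : ∃ d, b = a + d := ⟨b - a, by ring⟩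
  obtain ⟨e, he⟩ : ∃ e, 1 = a + d + e := ⟨1 - (a + d), by ring⟩
  have hd : 0 ≤ d := by linarith
  have he0 : 0 ≤ e := by linarith
  have hpi : 1 ≤ Real.pi ^ 2 / 6 := by nlinarith [Real.pi_gt_three]
  have h1 : d ^ 3 ≤ 4 * (a + d) ^ 3 - 3 * (a + d) ^ 4 - (4 * a ^ 3 - 3 * a ^ 4) := by
    have : 4 * (a + d) ^ 3 - 3 * (a + d) ^ 4 - (4 * a ^ 3 - 3 * a ^ 4) - d ^ 3
        = d * (6 * a ^ 2 * d + 3 * a * d ^ 2 + 12 * e * a ^ 2 + 12 * e * a * d + 3 * e * d ^ 2)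
          := by
      have h2 : a = 1 - d - e := by linarith
      subst h2
      ring
    have h3 : 0 ≤ d * (6 * a ^ 2 * d + 3 * a * d ^ 2 + 12 * e * a ^ 2 + 12 * e * a * d
        + 3 * e * d ^ 2) := by positivity
    linarith
  have h0 : 0 ≤ d ^ 3 := by positivity
  simp only [slitTime]
  rw [← mul_sub, add_sub_cancel_left]
  exact h1.trans (le_mul_of_one_le_left (h0.trans h1) hpi)

theorem slitTime_lt_slitTime {a b : ℝ} (ha : 0 ≤ a) (hab : a < b) (hb : b ≤ 1) :
    slitTime a < slitTime b := by
  have h1 := cube_sub_le_slitTime_sub ha hab.le hb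
  have : 0 < (b - a) ^ 3 := pow_pos (sub_pos.2 hab) 3
  linarith

@[simp] theorem slitTime_zero : slitTime 0 = 0 := by simp [slitTime]

theorem slitTime_one : slitTime 1 = Real.pi ^ 2 / 6 := by norm_num [slitTime]

theorem slitTime_mem {r : ℝ} (hr : r ∈ Ico (0 : ℝ) 1) :
    slitTime r ∈ Ico 0 (Real.pi ^ 2 / 6) := by
  refine ⟨?_, slitTime_one ▸ slitTime_lt_slitTime hr.1 hr.2 le_rfl⟩
  rcases hr.1.eq_or_lt with h | h
  · simp [← h]
  · exact (slitTime_zero ▸ slitTime_lt_slitTime le_rfl h hr.2.le).le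

theorem continuous_slitTime : Continuous slitTime := by
  unfold slitTime
  fun_prop

theorem slitTime_image {t : ℝ} (ht : t ∈ Ico 0 (Real.pi ^ 2 / 6)) :
    t ∈ slitTime '' Ico 0 1 := by
  have := intermediate_value_Icc zero_le_one continuous_slitTime.continuousOn
  rw [slitTime_zero, slitTime_one] at this
  obtain ⟨r, hr, rfl⟩ := this (Ico_subset_Icc_self ht)
  refine ⟨r, ⟨hr.1, lt_of_le_of_ne hr.2 ?_⟩, rfl⟩
  rintro rfl
  rw [slitTime_one] at ht
  exact lt_irrefl _ ht.2

theorem slitParam_mem {t : ℝ} (ht : t ∈ Ico 0 (Real.pi ^ 2 / 6)) : slitParam t ∈ Ico (0 : ℝ) 1 :=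
  Function.invFunOn_mem (slitTime_image ht)

theorem slitTime_slitParam {t : ℝ} (ht : t ∈ Ico 0 (Real.pi ^ 2 / 6)) :
    slitTime (slitParam t) = t :=
  Function.invFunOn_eq (slitTime_image ht)

theorem injOn_slitTime : InjOn slitTime (Ico 0 1) := by
  intro a ha b hb h
  rcases lt_trichotomy a b with h' | h' | h'
  · exact absurd h (slitTime_lt_slitTime ha.1 h' hb.2.le).ne
  · exact h'
  · exact absurd h (slitTime_lt_slitTime hb.1 h' ha.2.le).ne'

theorem slitParam_slitTime {r : ℝ} (hr : r ∈ Ico (0 : ℝ) 1) : slitParam (slitTime r) = r :=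
  injOn_slitTime (slitParam_mem (slitTime_mem hr)) hr (slitTime_slitParam (slitTime_mem hr))

@[simp] theorem slitParam_zero : slitParam 0 = 0 := by
  simpa using slitParam_slitTime (r := 0) ⟨le_rfl, one_pos⟩

theorem slitParam_pos {t : ℝ} (ht : t ∈ Ioo 0 (Real.pi ^ 2 / 6)) : slitParam t ∈ Ioo (0 : ℝ) 1 := by
  have h := slitParam_mem (Ioo_subset_Ico_self ht)
  refine ⟨lt_of_le_of_ne h.1 fun h0 => ?_, h.2⟩
  have := slitTime_slitParam (Ioo_subset_Ico_self ht)
  rw [← h0, slitTime_zero] at this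
  exact ht.1.ne this

theorem abs_slitParam_sub_pow_le {s t : ℝ} (hs : s ∈ Ico 0 (Real.pi ^ 2 / 6))
    (ht : t ∈ Ico 0 (Real.pi ^ 2 / 6)) : |slitParam s - slitParam t| ^ 3 ≤ |s - t| := by
  wlog h : slitParam s ≤ slitParam t generalizing s t
  · rw [abs_sub_comm, abs_sub_comm s]
    exact this ht hs (le_of_not_ge h)
  have key := cube_sub_le_slitTime_sub (slitParam_mem hs).1 h (slitParam_mem ht).2.le
  rw [slitTime_slitParam hs, slitTime_slitParam ht] at key
  rw [abs_sub_comm, abs_of_nonneg (sub_nonneg.2 h), abs_sub_comm]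
  exact key.trans (le_abs_self _)

theorem abs_slitParam_sub_le {s t : ℝ} (hs : s ∈ Ico 0 (Real.pi ^ 2 / 6))
    (ht : t ∈ Ico 0 (Real.pi ^ 2 / 6)) :
    |slitParam s - slitParam t| ≤ |s - t| ^ (1 / 3 : ℝ) := by
  have h := Real.rpow_le_rpow (by positivity) (abs_slitParam_sub_pow_le hs ht)
    (by norm_num : (0 : ℝ) ≤ 1 / 3)
  rwa [← Real.rpow_natCast, ← Real.rpow_mul (abs_nonneg _),
    (by norm_num : ((3 : ℕ) : ℝ) * (1 / 3) = 1), Real.rpow_one] at h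

theorem holderOnWith_of_abs_sub_le {f : ℝ → ℝ} {s : Set ℝ} {C r : NNReal}
    (h : ∀ x ∈ s, ∀ y ∈ s, |f x - f y| ≤ C * |x - y| ^ (r : ℝ)) : HolderOnWith C r f s := by
  intro x hx y hy
  rw [edist_dist, edist_dist, Real.dist_eq, Real.dist_eq,
    ENNReal.ofReal_rpow_of_nonneg (abs_nonneg _) r.coe_nonneg, ← ENNReal.ofReal_coe_nnreal,
    ← ENNReal.ofReal_mul C.coe_nonneg]
  exact ENNReal.ofReal_le_ofReal (h x hx y hy)

theorem holderOnWith_slitParam :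
    HolderOnWith 1 (1 / 3) slitParam (Ico 0 (Real.pi ^ 2 / 6)) :=
  holderOnWith_of_abs_sub_le fun x hx y hy => by
    simpa using abs_slitParam_sub_le hx hy

theorem continuousOn_slitParam : ContinuousOn slitParam (Ico 0 (Real.pi ^ 2 / 6)) :=
  holderOnWith_slitParam.continuousOn (by norm_num)

theorem continuousOn_slitDriving : ContinuousOn slitDriving (Ico 0 (Real.pi ^ 2 / 6)) := by
  have := continuousOn_slitParam
  unfold slitDriving
  fun_prop

theorem holderOnWith_slitDriving :
    HolderOnWith (4 * NNReal.pi) (1 / 3) slitDriving (Ico 0 (Real.pi ^ 2 / 6)) :=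
  holderOnWith_of_abs_sub_le fun x hx y hy => by
    have hx' := slitParam_mem hx
    have hy' := slitParam_mem hy
    have e : slitDriving x - slitDriving y
        = Real.pi * (2 - 3 * (slitParam x + slitParam y)) * (slitParam x - slitParam y) := by
      simp only [slitDriving]
      ring
    have h2 : |2 - 3 * (slitParam x + slitParam y)| ≤ 4 :=
      abs_le.2 ⟨by linarith [hx'.2, hy'.2], by linarith [hx'.1, hy'.1]⟩
    rw [e, abs_mul, abs_mul, abs_of_pos Real.pi_pos]
    have h3 := abs_slitParam_sub_le hx hy
    have h4 : ((4 * NNReal.pi : NNReal) : ℝ) = Real.pi * 4 := by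
      push_cast
      rw [NNReal.coe_real_pi]
      ring
    rw [h4]
    have h5 : (((1 / 3 : NNReal)) : ℝ) = 1 / 3 := by push_cast; rfl
    rw [h5]
    have := Real.pi_pos
    gcongr

theorem hasDerivAt_slitTime (r : ℝ) :
    HasDerivAt slitTime (2 * Real.pi ^ 2 * r ^ 2 * (1 - r)) r := by
  have h := (((hasDerivAt_pow 3 r).const_mul 4).sub
    ((hasDerivAt_pow 4 r).const_mul 3)).const_mul (Real.pi ^ 2 / 6)
  refine h.congr_deriv ?_
  push_cast
  ring

theorem analyticAt_of_left_inverse {f g : ℝ → ℝ} {x : ℝ} (hf : AnalyticAt ℝ f x)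
    (hf' : deriv f x ≠ 0) (hg : ∀ᶠ y in 𝓝 x, g (f y) = y) : AnalyticAt ℝ g (f x) :=
  (hf.analyticAt_localInverse hf').congr
    ((HasStrictFDerivAt.localInverse_unique _ hg).mono fun _ h => h.symm)

theorem slitParam_slitTime_eventually {t : ℝ} (ht : t ∈ Ioo 0 (Real.pi ^ 2 / 6)) :
    ∀ᶠ r in 𝓝 (slitParam t), slitParam (slitTime r) = r := by
  filter_upwards [isOpen_Ioo.mem_nhds (slitParam_pos ht)] with r hr
    using slitParam_slitTime (Ioo_subset_Ico_self hr)

theorem deriv_slitTime_slitParam_ne_zero {t : ℝ} (ht : t ∈ Ioo 0 (Real.pi ^ 2 / 6)) :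
    2 * Real.pi ^ 2 * slitParam t ^ 2 * (1 - slitParam t) ≠ 0 := by
  have h := slitParam_pos ht
  have h1 := h.1
  have h2 : 0 < 1 - slitParam t := sub_pos.2 h.2
  positivity

theorem analyticAt_slitTime (r : ℝ) : AnalyticAt ℝ slitTime r := by
  unfold slitTime
  fun_prop

theorem analyticAt_slitParam {t : ℝ} (ht : t ∈ Ioo 0 (Real.pi ^ 2 / 6)) :
    AnalyticAt ℝ slitParam t := by
  have := analyticAt_of_left_inverse (analyticAt_slitTime (slitParam t))
    (by rw [(hasDerivAt_slitTime _).deriv]; exact deriv_slitTime_slitParam_ne_zero ht)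
    (slitParam_slitTime_eventually ht)
  rwa [slitTime_slitParam (Ioo_subset_Ico_self ht)] at this

theorem hasDerivAt_slitParam {t : ℝ} (ht : t ∈ Ioo 0 (Real.pi ^ 2 / 6)) :
    HasDerivAt slitParam (2 * Real.pi ^ 2 * slitParam t ^ 2 * (1 - slitParam t))⁻¹ t := by
  have hs := (analyticAt_slitTime (slitParam t)).hasStrictDerivAt
  rw [(hasDerivAt_slitTime _).deriv] at hs
  have := (hs.to_local_left_inverse (deriv_slitTime_slitParam_ne_zero ht)
    (slitParam_slitTime_eventually ht)).hasDerivAt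
  rwa [slitTime_slitParam (Ioo_subset_Ico_self ht)] at this

theorem analyticOnNhd_slitDriving : AnalyticOnNhd ℝ slitDriving (Ioo 0 (Real.pi ^ 2 / 6)) := by
  intro t ht
  have := analyticAt_slitParam ht
  unfold slitDriving
  fun_prop

/-! ### Expansions in powers of `t^(1/3)` and the endpoints of the image interval. -/

theorem AnalyticAt.exists_eq_mul_self {f : ℝ → ℝ} (hf : AnalyticAt ℝ f 0) (h0 : f 0 = 0) :
    ∃ q : ℝ → ℝ, AnalyticAt ℝ q 0 ∧ q 0 = deriv f 0 ∧ ∀ s, f s = s * q s := by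
  obtain ⟨p, hp⟩ := hf
  refine ⟨dslope f 0, ⟨_, hp.has_fpower_series_dslope_fslope⟩, dslope_same _ _, fun s => ?_⟩
  have := sub_smul_dslope f 0 s
  simpa [h0] using this.symm

theorem AnalyticAt.exists_eq_linear_add {f : ℝ → ℝ} (hf : AnalyticAt ℝ f 0) (h0 : f 0 = 0) :
    ∃ q : ℝ → ℝ, AnalyticAt ℝ q 0 ∧ ∀ s, f s = deriv f 0 * s + s ^ 2 * q s := by
  obtain ⟨q, hq, hq0, hfq⟩ := hf.exists_eq_mul_self h0
  obtain ⟨p, hp, -, hqp⟩ := (hq.sub analyticAt_const (g := fun _ => q 0)).exists_eq_mul_self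
    (by simp)
  refine ⟨p, hp, fun s => ?_⟩
  have := hqp s
  simp only [Pi.sub_apply] at this
  rw [hfq, ← hq0, ← sub_add_cancel (q s) (q 0), this]
  ring

/-- Near `t = 0` the parameter is an analytic function of `t ^ (1 / 3)`. -/
theorem exists_slitParam_eq : ∃ (κ : ℝ) (q : ℝ → ℝ), 0 < κ ∧ κ ^ 3 = 3 / (2 * Real.pi ^ 2) ∧
    AnalyticAt ℝ q 0 ∧ ∀ᶠ t in 𝓝[≥] (0 : ℝ), slitParam t
      = κ * t ^ (1 / 3 : ℝ) + (t ^ (1 / 3 : ℝ)) ^ 2 * q (t ^ (1 / 3 : ℝ)) := by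
  have hpi := Real.pi_pos
  obtain ⟨κ, hκdef⟩ : ∃ κ, κ = (3 / (2 * Real.pi ^ 2)) ^ (1 / 3 : ℝ) := ⟨_, rfl⟩
  have hκ : 0 < κ := by rw [hκdef]; positivity
  have hκ3 : κ ^ 3 = 3 / (2 * Real.pi ^ 2) := by
    rw [hκdef, ← Real.rpow_natCast, ← Real.rpow_mul (by positivity)]
    norm_num
  -- Since `slitTime r = κ⁻³ r³ (1 - 3r/4)`, this is its cube root for `0 ≤ r < 1`; writing the last
  -- factor as `exp (log / 3)` makes it analytic at `0`. Its local inverse expresses `r` through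
  -- `t^(1/3)`.
  let Φ : ℝ → ℝ := fun r => κ⁻¹ * (r * Real.exp (Real.log (1 - 3 / 4 * r) / 3))
  have hΦa : AnalyticAt ℝ Φ 0 := by
    have h1 : AnalyticAt ℝ (fun r : ℝ => Real.log (1 - 3 / 4 * r)) 0 :=
      AnalyticAt.log (by fun_prop) (by norm_num)
    have h2 : AnalyticAt ℝ (fun r : ℝ => Real.exp (Real.log (1 - 3 / 4 * r) / 3)) 0 :=
      (h1.div_const).rexp
    exact analyticAt_const.mul (analyticAt_id.mul h2)
  have hΦ0 : Φ 0 = 0 := by simp [Φ]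
  have hΦd : deriv Φ 0 = κ⁻¹ := by
    have h2 : DifferentiableAt ℝ (fun r : ℝ => Real.exp (Real.log (1 - 3 / 4 * r) / 3)) 0 := by
      have h1 : DifferentiableAt ℝ (fun r : ℝ => Real.log (1 - 3 / 4 * r)) 0 :=
        DifferentiableAt.log (by fun_prop) (by norm_num)
      exact (h1.div_const 3).exp
    have := ((hasDerivAt_id (0 : ℝ)).mul h2.hasDerivAt).const_mul κ⁻¹
    refine this.deriv.trans ?_
    simp
  have hΦd0 : deriv Φ 0 ≠ 0 := hΦd ▸ inv_ne_zero hκ.ne'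
  have hs := hΦa.hasStrictDerivAt
  set ρ := hs.localInverse _ _ _ hΦd0 with hρ
  have hρa : AnalyticAt ℝ ρ 0 := by
    have := hΦa.analyticAt_localInverse hΦd0
    rwa [hΦ0] at this
  have hleft : ∀ᶠ r in 𝓝 0, ρ (Φ r) = r := hs.eventually_left_inverse hΦd0
  have hρ0 : ρ 0 = 0 := by
    have := hleft.self_of_nhds
    rwa [hΦ0] at this
  have hρd : deriv ρ 0 = κ := by
    have h5 : deriv ρ (Φ 0) = (deriv Φ 0)⁻¹ := (hs.to_localInverse hΦd0).hasDerivAt.deriv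
    rw [hΦ0] at h5
    exact h5.trans (by rw [hΦd, inv_inv])
  obtain ⟨q, hq, hρq⟩ := hρa.exists_eq_linear_add hρ0
  refine ⟨κ, q, hκ, hκ3, hq, ?_⟩
  have hTpos : (0 : ℝ) < Real.pi ^ 2 / 6 := by positivity
  have hcont : Tendsto slitParam (𝓝[≥] 0) (𝓝 0) := by
    have := continuousOn_slitParam 0 ⟨le_rfl, hTpos⟩
    rw [ContinuousWithinAt, slitParam_zero] at this
    rwa [nhdsWithin_Ico_eq_nhdsGE hTpos] at this
  filter_upwards [hcont.eventually hleft, Ico_mem_nhdsGE hTpos] with t ht htT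
  rw [← hρd, ← hρq]
  refine ht.symm.trans (congrArg ρ ?_)
  have hr := slitParam_mem htT
  have hpos : 0 < 1 - 3 / 4 * slitParam t := by linarith [hr.2]
  have hΦt : 0 ≤ Φ (slitParam t) := by
    have := hr.1
    positivity
  refine (pow_left_inj₀ hΦt (Real.rpow_nonneg htT.1 _) three_ne_zero).1 ?_
  have h3 := slitTime_slitParam htT
  rw [slitTime] at h3
  simp only [Φ]
  rw [mul_pow, mul_pow, ← Real.exp_nat_mul, inv_pow, hκ3, ← Real.rpow_natCast (t ^ (1 / 3 : ℝ)),
    ← Real.rpow_mul htT.1]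
  have h4 : ((3 : ℕ) : ℝ) * (Real.log (1 - 3 / 4 * slitParam t) / 3)
      = Real.log (1 - 3 / 4 * slitParam t) := by push_cast; ring
  rw [h4, Real.exp_log hpos]
  norm_num
  linear_combination h3

/-- The left endpoint of the image of the circular slit at time `t`. -/
noncomputable def slitLeft (t : ℝ) : ℝ := -Real.pi * slitParam t ^ 2

/-- The right endpoint of the image of the circular slit at time `t`. -/
noncomputable def slitRight (t : ℝ) : ℝ := 2 * Real.pi * slitParam t - Real.pi * slitParam t ^ 2

theorem slitLeft_lt_slitDriving {t : ℝ} (ht : t ∈ Ioo 0 (Real.pi ^ 2 / 6)) :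
    slitLeft t < slitDriving t := by
  have h := slitParam_pos ht
  have h1 : 0 < 2 * Real.pi * (slitParam t * (1 - slitParam t)) :=
    mul_pos (by positivity) (mul_pos h.1 (sub_pos.2 h.2))
  simp only [slitLeft, slitDriving]
  linarith

theorem slitDriving_lt_slitRight {t : ℝ} (ht : t ∈ Ioo 0 (Real.pi ^ 2 / 6)) :
    slitDriving t < slitRight t := by
  have h := slitParam_pos ht
  have h1 : 0 < 2 * Real.pi * slitParam t ^ 2 := mul_pos (by positivity) (pow_pos h.1 2)
  simp only [slitRight, slitDriving]
  linarith

theorem hasDerivAt_slitLeft {t : ℝ} (ht : t ∈ Ioo 0 (Real.pi ^ 2 / 6)) :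
    HasDerivAt slitLeft (2 / (slitLeft t - slitDriving t)) t := by
  have h := slitParam_pos ht
  refine (((hasDerivAt_slitParam ht).pow 2).const_mul (-Real.pi)).congr_deriv ?_
  have e : slitLeft t - slitDriving t = -(2 * Real.pi * slitParam t * (1 - slitParam t)) := by
    simp only [slitLeft, slitDriving]
    ring
  rw [e]
  have h1 := h.1.ne'
  have h2 := (sub_pos.2 h.2).ne'
  have h3 := Real.pi_ne_zero
  push_cast
  field_simp

theorem hasDerivAt_slitRight {t : ℝ} (ht : t ∈ Ioo 0 (Real.pi ^ 2 / 6)) :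
    HasDerivAt slitRight (2 / (slitRight t - slitDriving t)) t := by
  have h := slitParam_pos ht
  refine (((hasDerivAt_slitParam ht).const_mul (2 * Real.pi)).sub
    (((hasDerivAt_slitParam ht).pow 2).const_mul Real.pi)).congr_deriv ?_
  have e : slitRight t - slitDriving t = 2 * Real.pi * slitParam t ^ 2 := by
    simp only [slitRight, slitDriving]
    ring
  rw [e]
  have h1 := h.1.ne'
  have h2 := (sub_pos.2 h.2).ne'
  have h3 := Real.pi_ne_zero
  push_cast
  field_simp

theorem eq_rpow_one_third_of_pow_eq {x y : ℝ} (hx : 0 ≤ x) (h : x ^ 3 = y) :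
    x = y ^ (1 / 3 : ℝ) := by
  rw [← h, ← Real.rpow_natCast, ← Real.rpow_mul hx]
  norm_num

theorem rpow_two_thirds_eq {t : ℝ} (ht : 0 ≤ t) : t ^ (2 / 3 : ℝ) = (t ^ (1 / 3 : ℝ)) ^ 2 := by
  rw [← Real.rpow_natCast, ← Real.rpow_mul ht]
  norm_num

theorem eq_rpow_one_third_pow {t : ℝ} (ht : 0 ≤ t) : t = (t ^ (1 / 3 : ℝ)) ^ 3 := by
  rw [← Real.rpow_natCast, ← Real.rpow_mul ht]
  norm_num

theorem two_pi_mul_eq_rpow {κ : ℝ} (hκ : 0 < κ) (hκ3 : κ ^ 3 = 3 / (2 * Real.pi ^ 2)) :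
    2 * Real.pi * κ = (12 * Real.pi) ^ (1 / 3 : ℝ) := by
  have := Real.pi_pos
  refine eq_rpow_one_third_of_pow_eq (by positivity) ?_
  rw [mul_pow, hκ3]
  field_simp
  norm_num

theorem pi_mul_sq_eq_rpow {κ : ℝ} (hκ : 0 < κ) (hκ3 : κ ^ 3 = 3 / (2 * Real.pi ^ 2)) :
    Real.pi * κ ^ 2 = (9 / (4 * Real.pi)) ^ (1 / 3 : ℝ) := by
  have := Real.pi_pos
  refine eq_rpow_one_third_of_pow_eq (by positivity) ?_
  rw [mul_pow, ← pow_mul, mul_comm 2 3, pow_mul, hκ3]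
  field_simp
  norm_num

theorem exists_slitDriving_eq : ∃ R : ℝ → ℝ, AnalyticAt ℝ R 0 ∧ ∀ᶠ t in 𝓝[≥] (0 : ℝ),
    slitDriving t = (12 * Real.pi) ^ (1 / 3 : ℝ) * t ^ (1 / 3 : ℝ)
      + t ^ (2 / 3 : ℝ) * R (t ^ (1 / 3 : ℝ)) := by
  obtain ⟨κ, q, hκ, hκ3, hq, h⟩ := exists_slitParam_eq
  refine ⟨fun s => 2 * Real.pi * q s - 3 * Real.pi * (κ + s * q s) ^ 2, by fun_prop, ?_⟩
  filter_upwards [h, self_mem_nhdsWithin] with t ht ht0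
  rw [slitDriving, ht, rpow_two_thirds_eq ht0, ← two_pi_mul_eq_rpow hκ hκ3]
  ring

theorem exists_slitLeft_eq : ∃ R : ℝ → ℝ, AnalyticAt ℝ R 0 ∧ ∀ᶠ t in 𝓝[≥] (0 : ℝ),
    slitLeft t = -(9 / (4 * Real.pi)) ^ (1 / 3 : ℝ) * t ^ (2 / 3 : ℝ)
      + t * R (t ^ (1 / 3 : ℝ)) := by
  obtain ⟨κ, q, hκ, hκ3, hq, h⟩ := exists_slitParam_eq
  refine ⟨fun s => -Real.pi * (2 * κ * q s + s * q s ^ 2), by fun_prop, ?_⟩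
  filter_upwards [h, self_mem_nhdsWithin] with t ht ht0
  rw [slitLeft, ht, rpow_two_thirds_eq ht0, ← pi_mul_sq_eq_rpow hκ hκ3]
  have e := eq_rpow_one_third_pow ht0
  set s := t ^ (1 / 3 : ℝ)
  rw [e]
  ring

theorem exists_slitRight_eq : ∃ R : ℝ → ℝ, AnalyticAt ℝ R 0 ∧ ∀ᶠ t in 𝓝[≥] (0 : ℝ),
    slitRight t = (12 * Real.pi) ^ (1 / 3 : ℝ) * t ^ (1 / 3 : ℝ)
      + t ^ (2 / 3 : ℝ) * R (t ^ (1 / 3 : ℝ)) := by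
  obtain ⟨κ, q, hκ, hκ3, hq, h⟩ := exists_slitParam_eq
  refine ⟨fun s => 2 * Real.pi * q s - Real.pi * (κ + s * q s) ^ 2, by fun_prop, ?_⟩
  filter_upwards [h, self_mem_nhdsWithin] with t ht ht0
  rw [slitRight, ht, rpow_two_thirds_eq ht0, ← two_pi_mul_eq_rpow hκ hκ3]
  ring

/-! ### The conserved quantity along the flow. -/

/-- The conserved quantity of the circular slit flow: it equals `-2π / z` along the solution
starting at `z`. -/
noncomputable def slitInvariant (r : ℝ) (w : ℂ) : ℂ :=
  -(2 * Real.pi * (1 - r)) / (w + Real.pi * r ^ 2)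
    + Complex.log (1 - 2 * Real.pi * r / (w + Real.pi * r ^ 2))

theorem add_ofReal_mem_upperHalf {w : ℂ} (hw : w ∈ upperHalf) (r : ℝ) :
    w + Real.pi * (r : ℂ) ^ 2 ∈ upperHalf := by
  have : (Real.pi : ℂ) * (r : ℂ) ^ 2 = ((Real.pi * r ^ 2 : ℝ) : ℂ) := by push_cast; rfl
  rw [this]
  change 0 < (w + ((Real.pi * r ^ 2 : ℝ) : ℂ)).im
  rw [Complex.add_im, Complex.ofReal_im, add_zero]
  exact hw

theorem ne_zero_of_mem_upperHalf {w : ℂ} (hw : w ∈ upperHalf) : w ≠ 0 := by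
  simpa using sub_ofReal_ne_zero_of_mem_upperHalf hw 0

theorem one_sub_div_mem_upperHalf {u : ℂ} (hu : u ∈ upperHalf) {a : ℝ} (ha : 0 < a) :
    1 - a / u ∈ upperHalf := by
  have h : (0 : ℝ) < u.im := hu
  have h0 : 0 < Complex.normSq u := Complex.normSq_pos.2 (ne_zero_of_mem_upperHalf hu)
  change 0 < (1 - (a : ℂ) / u).im
  rw [Complex.sub_im, Complex.div_im]
  simp only [Complex.one_im, Complex.ofReal_im, Complex.ofReal_re, zero_mul, zero_div, zero_sub,
    neg_neg]
  positivity

theorem mem_slitPlane_of_mem_upperHalf {u : ℂ} (hu : u ∈ upperHalf) : u ∈ Complex.slitPlane :=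
  Or.inr (ne_of_gt hu)

theorem one_sub_div_mem_slitPlane {w : ℂ} (hw : w ∈ upperHalf) {r : ℝ} (hr : 0 ≤ r) :
    1 - 2 * Real.pi * r / (w + Real.pi * (r : ℂ) ^ 2) ∈ Complex.slitPlane := by
  rcases hr.eq_or_lt with h | h
  · simp [← h]
  · have := one_sub_div_mem_upperHalf (add_ofReal_mem_upperHalf hw r)
      (a := 2 * Real.pi * r) (by positivity)
    push_cast at this
    exact mem_slitPlane_of_mem_upperHalf this

/-- In the variables `r` and `u = w + πr²` one has `w - λ = u - 2πr(1 - r)` and `dr/dt = 1/(2π²r²(1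
- r))`. The derivative of `u` collapses to a single fraction, and those of the pole and of the
logarithm cancel as rational functions of `r` and `u`. -/
theorem hasDerivAt_slitInvariant {g : ℝ → ℂ} {s : ℝ} (hs : s ∈ Ioo 0 (Real.pi ^ 2 / 6))
    (hg : HasDerivAt g (2 / (g s - (slitDriving s : ℂ))) s) (hgs : g s ∈ upperHalf) :
    HasDerivAt (fun s => slitInvariant (slitParam s) (g s)) 0 s := by
  have hr := slitParam_pos hs
  have hr' := (hasDerivAt_slitParam hs).ofReal_comp
  have hu := add_ofReal_mem_upperHalf hgs (slitParam s)
  have hu0 := ne_zero_of_mem_upperHalf hu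
  have hζ := one_sub_div_mem_slitPlane hgs hr.1.le
  have hd := sub_ofReal_ne_zero_of_mem_upperHalf hgs (slitDriving s)
  have hr1 : (slitParam s : ℂ) ≠ 0 := by exact_mod_cast hr.1.ne'
  have hr2 : (1 : ℂ) - (slitParam s : ℂ) ≠ 0 := by exact_mod_cast (sub_pos.2 hr.2).ne'
  have hpi : (Real.pi : ℂ) ≠ 0 := by exact_mod_cast Real.pi_ne_zero
  have hd' : g s - (slitDriving s : ℂ) = (g s + Real.pi * (slitParam s : ℂ) ^ 2)
      - 2 * Real.pi * slitParam s * (1 - slitParam s) := by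
    simp only [slitDriving]
    push_cast
    ring
  rw [hd'] at hd hg
  have hU : HasDerivAt (fun s => g s + Real.pi * (slitParam s : ℂ) ^ 2)
      ((g s + Real.pi * (slitParam s : ℂ) ^ 2) / (Real.pi * slitParam s * (1 - slitParam s)
        * ((g s + Real.pi * (slitParam s : ℂ) ^ 2)
          - 2 * Real.pi * slitParam s * (1 - slitParam s)))) s := by
    refine (hg.add ((hr'.pow 2).const_mul (Real.pi : ℂ))).congr_deriv ?_
    push_cast
    generalize (slitParam s : ℂ) = r at *
    generalize g s + Real.pi * r ^ 2 = u at *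
    field_simp
    ring
  have h1 := (((hr'.const_sub 1).const_mul (2 * Real.pi : ℂ)).neg).div hU hu0
  have h2 := HasDerivAt.clog_real (((hr'.const_mul (2 * Real.pi : ℂ)).div hU hu0).const_sub 1) hζ
  refine (h1.add h2).congr_deriv ?_
  have hζ0 := Complex.slitPlane_ne_zero hζ
  simp only [Pi.div_apply, Pi.neg_apply]
  push_cast
  generalize (slitParam s : ℂ) = r at *
  generalize g s + Real.pi * r ^ 2 = u at *
  have hζ1 : u - 2 * Real.pi * r ≠ 0 := by
    intro h
    apply hζ0
    rw [sub_eq_zero.1 h, div_self, sub_self]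
    exact sub_eq_zero.1 h ▸ hu0
  have hζ2 : 1 - 2 * Real.pi * r / u = (u - 2 * Real.pi * r) / u := by field_simp
  rw [hζ2]
  field_simp
  ring

theorem slitInvariant_zero (w : ℂ) : slitInvariant 0 w = -(2 * Real.pi) / w := by
  simp [slitInvariant]

/-- The inverse flow map of the circular slit. -/
theorem slitInvariant_eq {t : ℝ} (ht : t ∈ Ico 0 (Real.pi ^ 2 / 6)) {w : ℂ} (hw : w ∈ upperHalf) :
    slitInvariant (slitParam t) w = -(2 * Real.pi) / loewnerInv slitDriving t w := by
  have hsub : Icc 0 t ⊆ Ico 0 (Real.pi ^ 2 / 6) := Icc_subset_Ico_right ht.2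
  have hlam := continuousOn_slitDriving.mono hsub
  have hsol := isLoewnerSolution_loewnerPath ht.1 hlam hw
  have hz := (loewnerInv_mem ht.1 hlam hw).1
  have hgt := loewnerPath_terminal ht.1 hlam hw
  have hg0 := hsol.1
  set g := loewnerPath slitDriving t w
  have hgH : ∀ s ∈ Icc 0 t, g s ∈ upperHalf := fun s hs => hsol.mem_upperHalf hlam hz hs
  let F : ℝ → ℂ := fun s => slitInvariant (slitParam s) (g s)
  have hF : ContinuousOn F (Icc 0 t) := by
    have h1 : ContinuousOn (fun s => (slitParam s : ℂ)) (Icc 0 t) :=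
      Complex.continuous_ofReal.comp_continuousOn (continuousOn_slitParam.mono hsub)
    have h2 : ContinuousOn (fun s => g s + Real.pi * (slitParam s : ℂ) ^ 2) (Icc 0 t) :=
      hsol.continuousOn.add (continuousOn_const.mul (h1.pow 2))
    have h3 : ∀ s ∈ Icc 0 t, g s + Real.pi * (slitParam s : ℂ) ^ 2 ≠ 0 := fun s hs =>
      ne_zero_of_mem_upperHalf (add_ofReal_mem_upperHalf (hgH s hs) _)
    exact ((continuousOn_const.mul (continuousOn_const.sub h1)).neg.div h2 h3).add
      ((continuousOn_const.sub ((continuousOn_const.mul h1).div h2 h3)).clog fun s hs =>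
        one_sub_div_mem_slitPlane (hgH s hs) (slitParam_mem (hsub hs)).1)
  -- `slitParam` behaves like `t^(1/3)` and is not differentiable at `0`, so constancy is obtained
  -- away from `0` and extended by continuity of `F`.
  have hconst : ∀ s ∈ Ioc 0 t, F t = F s := by
    intro s hs
    refine constant_of_has_deriv_right_zero (hF.mono (Icc_subset_Icc_left hs.1.le)) (fun x hx => ?_)
      t ⟨hs.2, le_rfl⟩
    have hx0 : 0 < x := hs.1.trans_le hx.1
    refine (hasDerivAt_slitInvariant ⟨hx0, hx.2.trans ht.2⟩ ?_ (hgH x ⟨hx0.le, hx.2.le⟩)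
      ).hasDerivWithinAt
    exact (hsol.2 x ⟨hx0.le, hx.2.le⟩).2.hasDerivAt (Icc_mem_nhds hx0 hx.2)
  have hFt : F t = F 0 := by
    rcases ht.1.eq_or_lt with h | h
    · rw [← h]
    · have h1 : Tendsto F (𝓝[>] 0) (𝓝 (F 0)) := by
        have := (hF 0 ⟨le_rfl, h.le⟩).mono Ioc_subset_Icc_self
        rwa [ContinuousWithinAt, nhdsWithin_Ioc_eq_nhdsGT h] at this
      refine tendsto_nhds_unique (Tendsto.congr' ?_ tendsto_const_nhds) h1
      filter_upwards [Ioc_mem_nhdsGT h] with s hs using hconst s hs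
  simpa only [F, hgt, hg0, slitParam_zero, Complex.ofReal_zero, slitInvariant_zero] using hFt

/-! ### The range of `p (ζ - 1) + log ζ` on the upper half-plane. -/

theorem mul_cos_le_sin {x : ℝ} (h0 : 0 < x) (hx : x < Real.pi) : x * Real.cos x ≤ Real.sin x := by
  rcases lt_or_ge x (Real.pi / 2) with h | h
  · have hc := Real.cos_pos_of_mem_Ioo ⟨by linarith, h⟩
    have := Real.lt_tan h0 h
    rw [Real.tan_eq_sin_div_cos, lt_div_iff₀ hc] at this
    exact this.le
  · have h1 := Real.cos_nonpos_of_pi_div_two_le_of_le h (by linarith)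
    have h2 := Real.sin_pos_of_pos_of_lt_pi h0 hx
    nlinarith

/-- The function `ζ ↦ p (ζ - 1) + log ζ` omits from the upper half-plane a horizontal ray. -/
theorem mul_add_log_mem {p : ℝ} (hp : 0 < p) {ζ : ℂ} (hζ : ζ ∈ upperHalf) :
    0 < (p * (ζ - 1) + Complex.log ζ).im ∧
      ¬ ((p * (ζ - 1) + Complex.log ζ).im = Real.pi ∧
        (p * (ζ - 1) + Complex.log ζ).re ≤ -(1 + p + Real.log p)) := by
  have him : 0 < ζ.im := hζ
  have hζ0 := ne_zero_of_mem_upperHalf hζ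
  have hρ : 0 < ‖ζ‖ := norm_pos_iff.2 hζ0
  have harg0 : 0 < ζ.arg := lt_of_le_of_ne (Complex.arg_nonneg_iff.2 him.le) fun h =>
    him.ne' (Complex.arg_eq_zero_iff.1 h.symm).2
  have hargpi : ζ.arg < Real.pi := lt_of_le_of_ne (Complex.arg_le_pi _) fun h =>
    him.ne' (Complex.arg_eq_pi_iff.1 h).2
  have e1 : (p * (ζ - 1) + Complex.log ζ).im = p * ζ.im + ζ.arg := by simp [Complex.log_im]
  have e2 : (p * (ζ - 1) + Complex.log ζ).re = p * (ζ.re - 1) + Real.log ‖ζ‖ := by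
    simp [Complex.log_re]
  rw [e1, e2]
  refine ⟨by positivity, fun ⟨h1, h2⟩ => ?_⟩
  -- With `arg ζ = π - ψ`, imaginary part `π` forces `p |ζ| = ψ / sin ψ > 1`. Then `log (p |ζ|) >
  -- 0`, while `ψ cos ψ ≤ sin ψ` gives `p |ζ| cos ψ ≤ 1`, so the real part lies strictly to the
  -- right of the tip.
  obtain ⟨ψ, hψ⟩ : ∃ ψ, ψ = Real.pi - ζ.arg := ⟨_, rfl⟩
  have harg : ζ.arg = Real.pi - ψ := by linarith
  have hψ0 : 0 < ψ := by linarith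
  have hψpi : ψ < Real.pi := by linarith
  have hsin : 0 < Real.sin ψ := Real.sin_pos_of_pos_of_lt_pi hψ0 hψpi
  have hre : ζ.re = -(‖ζ‖ * Real.cos ψ) := by
    rw [← Complex.norm_mul_cos_arg, harg, Real.cos_pi_sub]
    ring
  have him2 : ζ.im = ‖ζ‖ * Real.sin ψ := by
    rw [← Complex.norm_mul_sin_arg, harg, Real.sin_pi_sub]
  have hpρ : p * ‖ζ‖ = ψ / Real.sin ψ := by
    rw [eq_div_iff hsin.ne', mul_assoc, ← him2]
    linarith
  have hgt : 1 < p * ‖ζ‖ := by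
    rw [hpρ, one_lt_div hsin]
    exact Real.sin_lt hψ0
  have hlog : 0 < Real.log p + Real.log ‖ζ‖ := by
    rw [← Real.log_mul hp.ne' hρ.ne']
    exact Real.log_pos hgt
  have hcos : p * ‖ζ‖ * Real.cos ψ ≤ 1 := by
    rw [hpρ, div_mul_eq_mul_div, div_le_one hsin]
    exact mul_cos_le_sin hψ0 hψpi
  rw [hre] at h2
  linarith

/-- The real part of `p (ζ - 1) + log ζ` at the point of argument `φ` where the imaginary part
equals `Y`. -/
noncomputable def levelRe (p Y φ : ℝ) : ℝ :=
  (Y - φ) / Real.sin φ * Real.cos φ - p + Real.log ((Y - φ) / Real.sin φ) - Real.log p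

/-- On the level `Im = Y` the argument `φ` forces the modulus: `p |ζ| sin φ = Y - φ`. Hence each
level curve is parametrised by `φ` and only the real part has to be followed. -/
theorem exists_of_levelRe {p Y φ : ℝ} (hp : 0 < p) (h0 : 0 < φ) (hφ : φ < Real.pi) (hY : φ < Y) :
    ∃ ζ ∈ upperHalf, p * (ζ - 1) + Complex.log ζ = ⟨levelRe p Y φ, Y⟩ := by
  have hsin : 0 < Real.sin φ := Real.sin_pos_of_pos_of_lt_pi h0 hφ
  obtain ⟨v, hv⟩ : ∃ v, v = (Y - φ) / Real.sin φ := ⟨_, rfl⟩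
  have hv0 : 0 < v := hv ▸ div_pos (sub_pos.2 hY) hsin
  have hρ : 0 < v / p := div_pos hv0 hp
  have harg : φ ∈ Ioc (-Real.pi) Real.pi := ⟨by linarith [Real.pi_pos], hφ.le⟩
  refine ⟨((v / p : ℝ) : ℂ) * (Complex.cos φ + Complex.sin φ * Complex.I), ?_, ?_⟩
  · change 0 < Complex.im _
    rw [← Complex.ofReal_cos, ← Complex.ofReal_sin]
    simp only [Complex.mul_im, Complex.add_im, Complex.ofReal_im, Complex.ofReal_re, Complex.I_im,
      Complex.I_re, Complex.add_re]
    ring_nf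
    positivity
  · have hl : Complex.log (((v / p : ℝ) : ℂ) * (Complex.cos φ + Complex.sin φ * Complex.I))
        = (Real.log v - Real.log p : ℝ) + φ * Complex.I := by
      rw [Complex.log, Complex.arg_mul_cos_add_sin_mul_I hρ harg,
        Complex.norm_mul, Complex.norm_cos_add_sin_mul_I, Complex.norm_real, Real.norm_eq_abs,
        abs_of_pos hρ, mul_one, Real.log_div hv0.ne' hp.ne']
    rw [hl, ← Complex.ofReal_cos, ← Complex.ofReal_sin]
    have e : v * Real.sin φ = Y - φ := by rw [hv, div_mul_cancel₀ _ hsin.ne']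
    apply Complex.ext
    · simp only [levelRe, ← hv]
      simp
      rw [← Complex.ofReal_cos, Complex.ofReal_re]
      field_simp
      ring
    · simp
      rw [← Complex.ofReal_sin, Complex.ofReal_re]
      field_simp
      linarith

theorem continuousOn_levelRe (p Y : ℝ) : ContinuousOn (levelRe p Y) (Ioo 0 (min Y Real.pi)) := by
  have hs : ∀ φ ∈ Ioo 0 (min Y Real.pi), Real.sin φ ≠ 0 := fun φ hφ =>
    (Real.sin_pos_of_pos_of_lt_pi hφ.1 (hφ.2.trans_le (min_le_right _ _))).ne'
  have h1 : ContinuousOn (fun φ => (Y - φ) / Real.sin φ) (Ioo 0 (min Y Real.pi)) :=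
    (continuousOn_const.sub continuousOn_id).div Real.continuous_sin.continuousOn hs
  refine ((((h1.mul Real.continuous_cos.continuousOn).sub continuousOn_const).add
    (h1.log fun φ hφ => ?_)).sub continuousOn_const)
  exact div_ne_zero (sub_pos.2 (hφ.2.trans_le (min_le_left _ _))).ne' (hs φ hφ)

theorem tendsto_sin_nhdsGT_zero : Tendsto Real.sin (𝓝[>] 0) (𝓝[>] 0) := by
  refine tendsto_nhdsWithin_iff.2 ⟨?_, ?_⟩
  · have := Real.continuous_sin.tendsto 0
    rw [Real.sin_zero] at this
    exact this.mono_left nhdsWithin_le_nhds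
  · filter_upwards [Ioo_mem_nhdsGT Real.pi_pos] with x hx
      using Real.sin_pos_of_pos_of_lt_pi hx.1 hx.2

theorem tendsto_sin_nhdsLT_pi : Tendsto Real.sin (𝓝[<] Real.pi) (𝓝[>] 0) := by
  refine tendsto_nhdsWithin_iff.2 ⟨?_, ?_⟩
  · have := Real.continuous_sin.tendsto Real.pi
    rw [Real.sin_pi] at this
    exact this.mono_left nhdsWithin_le_nhds
  · filter_upwards [Ioo_mem_nhdsLT Real.pi_pos] with x hx
      using Real.sin_pos_of_pos_of_lt_pi hx.1 hx.2

theorem tendsto_levelRe_zero (p : ℝ) {Y : ℝ} (hY : 0 < Y) :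
    Tendsto (levelRe p Y) (𝓝[>] 0) atTop := by
  have h0 : Tendsto (fun φ : ℝ => Y - φ) (𝓝[>] 0) (𝓝 Y) := by
    have : Tendsto (fun φ : ℝ => Y - φ) (𝓝 0) (𝓝 (Y - 0)) := (continuous_sub_left Y).tendsto 0
    rw [sub_zero] at this
    exact this.mono_left nhdsWithin_le_nhds
  have hv : Tendsto (fun φ => (Y - φ) / Real.sin φ) (𝓝[>] 0) atTop :=
    h0.pos_mul_atTop hY (tendsto_inv_nhdsGT_zero.comp tendsto_sin_nhdsGT_zero)
  have hc : Tendsto Real.cos (𝓝[>] 0) (𝓝 1) := by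
    have := Real.continuous_cos.tendsto 0
    rw [Real.cos_zero] at this
    exact this.mono_left nhdsWithin_le_nhds
  exact tendsto_atTop_add_const_right _ _ ((tendsto_atTop_add_const_right _ _
    (hv.atTop_mul_pos one_pos hc)).atTop_add_atTop (Real.tendsto_log_atTop.comp hv))

theorem tendsto_levelRe_of_lt (p : ℝ) {Y : ℝ} (hY : 0 < Y) (hYpi : Y < Real.pi) :
    Tendsto (levelRe p Y) (𝓝[<] Y) atBot := by
  have hsin := Real.sin_pos_of_pos_of_lt_pi hY hYpi
  have hv : Tendsto (fun φ => (Y - φ) / Real.sin φ) (𝓝[<] Y) (𝓝[>] 0) := by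
    refine tendsto_nhdsWithin_iff.2 ⟨?_, ?_⟩
    · have : ContinuousAt (fun φ => (Y - φ) / Real.sin φ) Y :=
        (continuousAt_const.sub continuousAt_id).div Real.continuous_sin.continuousAt hsin.ne'
      have := this.tendsto
      rw [sub_self, zero_div] at this
      exact this.mono_left nhdsWithin_le_nhds
    · filter_upwards [Ioo_mem_nhdsLT hY] with φ hφ
      exact div_pos (sub_pos.2 hφ.2) (Real.sin_pos_of_pos_of_lt_pi hφ.1 (hφ.2.trans hYpi))
  have hc : Tendsto Real.cos (𝓝[<] Y) (𝓝 (Real.cos Y)) :=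
    (Real.continuous_cos.tendsto Y).mono_left nhdsWithin_le_nhds
  have h1 := (((tendsto_nhdsWithin_iff.1 hv).1.mul hc).sub_const p).add_atBot
    (Real.tendsto_log_nhdsGT_zero.comp hv)
  exact tendsto_atBot_add_const_right _ _ h1

theorem tendsto_levelRe_of_gt (p : ℝ) {Y : ℝ} (hY : Real.pi < Y) :
    Tendsto (levelRe p Y) (𝓝[<] Real.pi) atBot := by
  have h0 : Tendsto (fun φ : ℝ => Y - φ) (𝓝[<] Real.pi) (𝓝 (Y - Real.pi)) :=
    ((continuous_sub_left Y).tendsto Real.pi).mono_left nhdsWithin_le_nhds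
  have hv : Tendsto (fun φ => (Y - φ) / Real.sin φ) (𝓝[<] Real.pi) atTop :=
    h0.pos_mul_atTop (sub_pos.2 hY) (tendsto_inv_nhdsGT_zero.comp tendsto_sin_nhdsLT_pi)
  have hc : ∀ᶠ φ in 𝓝[<] Real.pi, Real.cos φ < -(1 / 2) := by
    have := Real.continuous_cos.tendsto Real.pi
    rw [Real.cos_pi] at this
    exact (this.mono_left nhdsWithin_le_nhds).eventually (gt_mem_nhds (by norm_num))
  -- The cosine contributes at most `-v/2` and the logarithm at most `v/4 - 1 + log 4`, leaving
  -- `-v/4`.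
  have hb : Tendsto (fun φ => -(1 / 4) * ((Y - φ) / Real.sin φ)
      + (-1 + Real.log 4 - p - Real.log p)) (𝓝[<] Real.pi) atBot :=
    tendsto_atBot_add_const_right _ _ (hv.const_mul_atTop_of_neg (by norm_num))
  refine tendsto_atBot_mono' _ ?_ hb
  filter_upwards [hc, hv.eventually_gt_atTop 0] with φ hφ hv0
  simp only [levelRe]
  generalize (Y - φ) / Real.sin φ = v at *
  have h1 : v * Real.cos φ ≤ v * (-(1 / 2)) := mul_le_mul_of_nonneg_left hφ.le hv0.le
  have h2 := Real.log_le_sub_one_of_pos (show 0 < v / 4 by positivity)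
  rw [Real.log_div hv0.ne' (by norm_num)] at h2
  linarith

theorem tendsto_levelRe_pi (p : ℝ) :
    Tendsto (levelRe p Real.pi) (𝓝[<] Real.pi) (𝓝 (-(1 + p + Real.log p))) := by
  have hv : Tendsto (fun φ => (Real.pi - φ) / Real.sin φ) (𝓝[<] Real.pi) (𝓝 1) := by
    have h1 : Tendsto (fun φ => (Real.sinc (Real.pi - φ))⁻¹) (𝓝 Real.pi) (𝓝 1) := by
      have : ContinuousAt (fun φ => (Real.sinc (Real.pi - φ))⁻¹) Real.pi :=
        ContinuousAt.inv₀ (Real.continuous_sinc.comp (continuous_sub_left _)).continuousAt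
          (by simp)
      simpa [ContinuousAt] using this
    refine (h1.mono_left nhdsWithin_le_nhds).congr' ?_
    filter_upwards [self_mem_nhdsWithin] with φ hφ
    rw [Real.sinc_of_ne_zero (sub_ne_zero.2 (ne_of_gt hφ)), Real.sin_pi_sub, inv_div]
  have hc : Tendsto Real.cos (𝓝[<] Real.pi) (𝓝 (-1)) := by
    have := Real.continuous_cos.tendsto Real.pi
    rw [Real.cos_pi] at this
    exact this.mono_left nhdsWithin_le_nhds
  have := (((hv.mul hc).sub_const p).add (hv.log one_ne_zero)).sub_const (Real.log p)
  rw [Real.log_one] at this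
  have e : -(1 + p + Real.log p) = 1 * -1 - p + 0 - Real.log p := by ring
  rw [e]
  exact this

/-- The function `ζ ↦ p (ζ - 1) + log ζ` attains every value in the upper half-plane outside a
horizontal ray. -/
theorem exists_mul_add_log_eq {p : ℝ} (hp : 0 < p) {W : ℂ} (hW : W ∈ upperHalf)
    (h : ¬ (W.im = Real.pi ∧ W.re ≤ -(1 + p + Real.log p))) :
    ∃ ζ ∈ upperHalf, p * (ζ - 1) + Complex.log ζ = W := by
  have hY : 0 < W.im := hW
  have hb : 0 < min W.im Real.pi := lt_min hY Real.pi_pos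
  have hl1 : 𝓝[>] (0 : ℝ) ≤ 𝓟 (Ioo 0 (min W.im Real.pi)) :=
    le_principal_iff.2 (Ioo_mem_nhdsGT hb)
  have hl2 : 𝓝[<] (min W.im Real.pi) ≤ 𝓟 (Ioo 0 (min W.im Real.pi)) :=
    le_principal_iff.2 (Ioo_mem_nhdsLT hb)
  have hcont := continuousOn_levelRe p W.im
  have htop := tendsto_levelRe_zero p hY
  -- The real part runs from `+∞` at `φ = 0` down to `-∞` at the other end, except on the level `π`,
  -- where its limit there is the abscissa of the tip.
  have key : W.re ∈ levelRe p W.im '' Ioo 0 (min W.im Real.pi) := by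
    rcases lt_trichotomy W.im Real.pi with h1 | h1 | h1
    · have hbot := tendsto_levelRe_of_lt p hY h1
      rw [← min_eq_left h1.le] at hbot
      nth_rw 1 [min_eq_left h1.le] at hbot
      exact isPreconnected_Ioo.intermediate_value_Iii hl2 hl1 hcont hbot htop (mem_univ _)
    · have hlim := tendsto_levelRe_pi p
      have hgt : -(1 + p + Real.log p) < W.re := by
        by_contra! hle
        exact h ⟨h1, hle⟩
      rw [h1] at htop
      rw [h1, min_self] at hl1 hl2 hcont ⊢
      exact isPreconnected_Ioo.intermediate_value_Ioi hl2 hl1 hcont hlim htop hgt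
    · have hbot := tendsto_levelRe_of_gt p h1
      rw [min_eq_right h1.le] at *
      exact isPreconnected_Ioo.intermediate_value_Iii hl2 hl1 hcont hbot htop (mem_univ _)
  obtain ⟨φ, hφ, hφW⟩ := key
  obtain ⟨ζ, hζ, e⟩ := exists_of_levelRe hp hφ.1 (hφ.2.trans_le (min_le_right _ _))
    (hφ.2.trans_le (min_le_left _ _))
  exact ⟨ζ, hζ, e.trans (Complex.ext hφW rfl)⟩

/-- Exhibits the invariant as the elementary map with `p = (1 - r)/r` after the Möbius map `w ↦ 1 -
2πr/(w + πr²)`. -/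
theorem slitInvariant_eq_mul_add_log {r : ℝ} (hr : 0 < r) (w : ℂ) :
    slitInvariant r w = ((1 - r) / r : ℝ)
      * ((1 - 2 * Real.pi * r / (w + Real.pi * r ^ 2)) - 1)
      + Complex.log (1 - 2 * Real.pi * r / (w + Real.pi * r ^ 2)) := by
  have hr0 : (r : ℂ) ≠ 0 := by exact_mod_cast hr.ne'
  simp only [slitInvariant]
  congr 1
  push_cast
  generalize w + Real.pi * (r : ℂ) ^ 2 = u
  field_simp
  ring

/-! ### The hulls of the explicit flow are the circular arcs. -/

/-- The normalised abscissa of the tip of the circular slit, after inversion at the origin. -/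
noncomputable def slitTip (r : ℝ) : ℝ := 1 + (1 - r) / r + Real.log ((1 - r) / r)

theorem slitInvariant_mem {r : ℝ} (hr : r ∈ Ioo (0 : ℝ) 1) {w : ℂ} (hw : w ∈ upperHalf) :
    0 < (slitInvariant r w).im ∧
      ¬ ((slitInvariant r w).im = Real.pi ∧ (slitInvariant r w).re ≤ -slitTip r) := by
  have hζ := one_sub_div_mem_upperHalf (add_ofReal_mem_upperHalf hw r) (a := 2 * Real.pi * r)
    (mul_pos (by positivity) hr.1)
  push_cast at hζ
  rw [slitInvariant_eq_mul_add_log hr.1]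
  exact mul_add_log_mem (div_pos (sub_pos.2 hr.2) hr.1) hζ

theorem exists_slitInvariant_eq {r : ℝ} (hr : r ∈ Ioo (0 : ℝ) 1) {W : ℂ} (hW : W ∈ upperHalf)
    (h : ¬ (W.im = Real.pi ∧ W.re ≤ -slitTip r)) :
    ∃ w ∈ upperHalf, slitInvariant r w = W := by
  obtain ⟨ζ, hζ, e⟩ := exists_mul_add_log_eq (div_pos (sub_pos.2 hr.2) hr.1) hW h
  have hζ1 : 1 - ζ ≠ 0 := by
    have := sub_ofReal_ne_zero_of_mem_upperHalf hζ 1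
    rwa [Complex.ofReal_one, ← neg_ne_zero, neg_sub] at this
  have hr0 : (r : ℂ) ≠ 0 := by exact_mod_cast hr.1.ne'
  have hpi : (Real.pi : ℂ) ≠ 0 := by exact_mod_cast Real.pi_ne_zero
  have hu : 0 < (((2 * Real.pi * r : ℝ) : ℂ) / (1 - ζ)).im := by
    have h0 : 0 < Complex.normSq (1 - ζ) := Complex.normSq_pos.2 hζ1
    have h1 : 0 < ζ.im := hζ
    have h2 := hr.1
    rw [Complex.div_im]
    simp only [Complex.sub_im, Complex.one_im, Complex.ofReal_im, Complex.ofReal_re, zero_mul,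
      zero_div, zero_sub, mul_neg, neg_div, neg_neg]
    positivity
  refine ⟨((2 * Real.pi * r : ℝ) : ℂ) / (1 - ζ) - ((Real.pi * r ^ 2 : ℝ) : ℂ), ?_, ?_⟩
  · change 0 < Complex.im _
    rwa [Complex.sub_im, Complex.ofReal_im, sub_zero]
  · rw [slitInvariant_eq_mul_add_log hr.1, ← e]
    have : 1 - 2 * Real.pi * r / (((2 * Real.pi * r : ℝ) : ℂ) / (1 - ζ)
        - ((Real.pi * r ^ 2 : ℝ) : ℂ) + Real.pi * r ^ 2) = ζ := by
      push_cast
      rw [sub_add_cancel]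
      field_simp
      ring
    rw [this]

/-- The circular slit is the image of a horizontal ray under an inversion at the origin. -/
theorem mem_circularSlit_iff (c : ℝ) (z : ℂ) :
    z ∈ circularSlit (Real.pi - 2 * Real.arctan c) ↔
      ∃ x : ℝ, x ≤ -(Real.pi * c) ∧ z = -(2 * Real.pi) / (x + Real.pi * Complex.I) := by
  have hpi := Real.pi_pos
  -- Half-angle substitution `u = π - 2v`: the point is `2i cos v · e^(-iv)`, and inversion sends it
  -- to `-π tan v + iπ`.
  have key : ∀ v : ℝ, v ∈ Ioo (-(Real.pi / 2)) (Real.pi / 2) →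
      Complex.I - Complex.I * Complex.exp ((Real.pi - 2 * v : ℝ) * Complex.I)
        = -(2 * Real.pi) / ((-(Real.pi * Real.tan v) : ℝ) + Real.pi * Complex.I) := by
    intro v hv
    have hc : (Real.cos v : ℂ) ≠ 0 := by exact_mod_cast (Real.cos_pos_of_mem_Ioo hv).ne'
    have hpi' : (Real.pi : ℂ) ≠ 0 := by exact_mod_cast hpi.ne'
    have h1 : Complex.exp ((Real.pi - 2 * v : ℝ) * Complex.I)
        = -((Real.cos v : ℂ) - Real.sin v * Complex.I) ^ 2 := by
      have h2 : ((Real.pi - 2 * v : ℝ) : ℂ) * Complex.I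
          = Real.pi * Complex.I + (2 : ℕ) * (((-v : ℝ) : ℂ) * Complex.I) := by
        push_cast
        ring
      rw [h2, Complex.exp_add, Complex.exp_pi_mul_I, Complex.exp_nat_mul, Complex.exp_mul_I,
        ← Complex.ofReal_cos, ← Complex.ofReal_sin, Real.cos_neg, Real.sin_neg]
      push_cast
      ring
    have h3 : (Real.cos v : ℂ) ^ 2 + (Real.sin v : ℂ) ^ 2 = 1 := by
      exact_mod_cast Real.cos_sq_add_sin_sq v
    have h4 : ((-(Real.pi * Real.tan v) : ℝ) + Real.pi * Complex.I : ℂ) ≠ 0 := by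
      intro h
      have := congrArg Complex.im h
      simp at this
    rw [h1, eq_div_iff h4, Real.tan_eq_sin_div_cos]
    push_cast
    rw [← Complex.ofReal_cos, ← Complex.ofReal_sin]
    generalize (Real.cos v : ℂ) = a at *
    generalize (Real.sin v : ℂ) = b at *
    field_simp
    have hI := Complex.I_sq
    linear_combination (-Complex.I * (-b + Complex.I * a) - 2 * a) * h3
      + (Complex.I * (-b + Complex.I * a) * b ^ 2
        + 2 * a * (-Complex.I * a * b + a ^ 2 + b ^ 2)) * hI
  constructor
  · rintro ⟨u, hu0, hu, rfl⟩
    have hv : (Real.pi - u) / 2 ∈ Ioo (-(Real.pi / 2)) (Real.pi / 2) :=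
      ⟨by linarith [Real.neg_pi_div_two_lt_arctan c], by linarith⟩
    refine ⟨-(Real.pi * Real.tan ((Real.pi - u) / 2)), ?_, ?_⟩
    · have h1 : Real.arctan c ≤ (Real.pi - u) / 2 := by linarith
      have h2 := (Real.strictMonoOn_tan.le_iff_le (Real.arctan_mem_Ioo c) hv).2 h1
      rw [Real.tan_arctan] at h2
      exact neg_le_neg (mul_le_mul_of_nonneg_left h2 hpi.le)
    · rw [← key _ hv]
      congr 4
      push_cast
      ring
  · rintro ⟨x, hx, rfl⟩
    have hv := Real.arctan_mem_Ioo (-x / Real.pi)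
    refine ⟨Real.pi - 2 * Real.arctan (-x / Real.pi), by linarith [hv.2], ?_, ?_⟩
    · have : c ≤ -x / Real.pi := by
        rw [le_div_iff₀ hpi]
        linarith
      linarith [Real.arctan_mono this]
    · rw [key _ hv, Real.tan_arctan]
      congr 2
      push_cast
      field_simp

theorem neg_two_pi_div_mem_upperHalf {z : ℂ} (hz : z ∈ upperHalf) :
    -(2 * Real.pi) / z ∈ upperHalf := by
  have h : 0 < z.im := hz
  have h0 : 0 < Complex.normSq z := Complex.normSq_pos.2 (ne_zero_of_mem_upperHalf hz)
  have e : (-(2 * Real.pi) / z : ℂ) = ((-(2 * Real.pi) : ℝ) : ℂ) / z := by push_cast; rfl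
  change 0 < (-(2 * Real.pi) / z : ℂ).im
  rw [e, Complex.div_im]
  simp only [Complex.ofReal_im, Complex.ofReal_re, zero_mul, zero_div, zero_sub, neg_mul, neg_div,
    neg_neg]
  have := Real.pi_pos
  positivity

theorem neg_two_pi_div_neg_two_pi_div (z : ℂ) :
    -(2 * Real.pi) / (-(2 * Real.pi) / z) = z := by
  have : (-(2 * Real.pi) : ℂ) ≠ 0 := by
    exact_mod_cast (neg_ne_zero.2 Real.two_pi_pos.ne')
  exact div_div_cancel₀ this

/-- The hulls of the circular slit flow. -/
theorem loewnerHull_slitDriving {t : ℝ} (ht : t ∈ Ioo 0 (Real.pi ^ 2 / 6)) :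
    loewnerHull slitDriving t
      = circularSlit (Real.pi - 2 * Real.arctan (slitTip (slitParam t) / Real.pi)) := by
  have ht' := Ioo_subset_Ico_self ht
  have hr := slitParam_pos ht
  have hlam : ContinuousOn slitDriving (Icc 0 t) :=
    continuousOn_slitDriving.mono (Icc_subset_Ico_right ht.2)
  have himg := loewnerInv_image ht.1.le hlam
  ext z
  rw [mem_circularSlit_iff, mul_div_cancel₀ _ Real.pi_ne_zero]
  constructor
  · intro hz
    have hzH : z ∈ upperHalf := hz.1
    have hW := neg_two_pi_div_mem_upperHalf hzH
    have : (-(2 * Real.pi) / z : ℂ).im = Real.pi ∧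
        (-(2 * Real.pi) / z : ℂ).re ≤ -slitTip (slitParam t) := by
      -- A value off the ray would be attained by the invariant, and conservation would then put `z`
      -- in the image of the inverse flow map, outside the hull.
      by_contra hcon
      obtain ⟨w, hw, hwW⟩ := exists_slitInvariant_eq hr hW hcon
      rw [slitInvariant_eq ht' hw] at hwW
      have h1 := loewnerInv_mem ht.1.le hlam hw
      rw [← neg_two_pi_div_neg_two_pi_div (loewnerInv slitDriving t w), hwW,
        neg_two_pi_div_neg_two_pi_div] at h1
      exact h1.2 hz
    refine ⟨_, this.2, ?_⟩
    nth_rw 1 [← neg_two_pi_div_neg_two_pi_div z]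
    congr 1
    apply Complex.ext
    · simp
    · simpa using this.1
  · rintro ⟨x, hx, rfl⟩
    have hxH : (x + Real.pi * Complex.I : ℂ) ∈ upperHalf := by
      simpa [upperHalf] using Real.pi_pos
    by_contra hcon
    have hz : -(2 * Real.pi) / (x + Real.pi * Complex.I : ℂ) ∈ upperHalf \ loewnerHull slitDriving t
      := ⟨neg_two_pi_div_mem_upperHalf hxH, hcon⟩
    rw [← himg] at hz
    obtain ⟨w, hw, hwz⟩ := hz
    have h1 := slitInvariant_mem hr hw
    rw [slitInvariant_eq ht' hw, hwz, neg_two_pi_div_neg_two_pi_div] at h1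
    exact h1.2 ⟨by simp, by simpa using hx⟩

theorem circularSlit_zero : circularSlit 0 = ∅ :=
  eq_empty_of_forall_notMem fun _ ⟨_, h0, h, _⟩ => absurd h0 (not_lt.2 h)

theorem loewnerHull_zero (lam : ℝ → ℝ) : loewnerHull lam 0 = ∅ := by
  refine eq_empty_of_forall_notMem fun z hz => hz.2 ⟨fun _ => z, rfl, fun s _ => ⟨?_, ?_⟩⟩
  · exact sub_ne_zero.1 (sub_ofReal_ne_zero_of_mem_upperHalf hz.1 _)
  · rw [Icc_self]
    -- At time `0` the interval is a single point, where every derivative is admissible, so the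
    -- constant function is a solution.
    exact HasFDerivWithinAt.singleton

/-- For `r = 1/(1 + eˣ)` the ratio `(1 - r)/r` is `eˣ`, and the abscissa becomes `1 + eˣ + x`, which
takes every real value. -/
theorem exists_slitTip_eq (c : ℝ) : ∃ r ∈ Ioo (0 : ℝ) 1, slitTip r = c := by
  have hsurj : Function.Surjective fun x : ℝ => 1 + Real.exp x + x := by
    refine Continuous.surjective (by fun_prop) ?_ ?_
    · exact (tendsto_atTop_add_const_left _ 1 Real.tendsto_exp_atTop).atTop_add_atTop tendsto_id
    · exact (Real.tendsto_exp_atBot.const_add 1).add_atBot tendsto_id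
  obtain ⟨x, hx⟩ := hsurj c
  have h0 := Real.exp_pos x
  refine ⟨1 / (1 + Real.exp x), ⟨by positivity, ?_⟩, ?_⟩
  · rw [div_lt_one (by positivity)]
    linarith
  · have : (1 - 1 / (1 + Real.exp x)) / (1 / (1 + Real.exp x)) = Real.exp x := by
      field_simp
      ring
    rw [slitTip, this, Real.log_exp]
    exact hx

/-- Every arc of the circle is a hull of the circular slit flow. -/
theorem exists_loewnerHull_slitDriving_eq {θ : ℝ} (hθ : θ ∈ Ico 0 (2 * Real.pi)) :
    ∃ t ∈ Ico 0 (Real.pi ^ 2 / 6), loewnerHull slitDriving t = circularSlit θ := by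
  rcases hθ.1.eq_or_lt with h | h
  · refine ⟨0, ⟨le_rfl, by have := Real.pi_pos; positivity⟩, ?_⟩
    rw [← h, circularSlit_zero, loewnerHull_zero]
  · obtain ⟨r, hr, hrc⟩ := exists_slitTip_eq (Real.pi * Real.tan ((Real.pi - θ) / 2))
    have hr' := Ioo_subset_Ico_self hr
    have ht : slitTime r ∈ Ioo 0 (Real.pi ^ 2 / 6) :=
      ⟨slitTime_zero ▸ slitTime_lt_slitTime le_rfl hr.1 hr.2.le, (slitTime_mem hr').2⟩
    refine ⟨slitTime r, Ioo_subset_Ico_self ht, ?_⟩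
    rw [loewnerHull_slitDriving ht, slitParam_slitTime hr', hrc,
      mul_div_cancel_left₀ _ Real.pi_ne_zero,
      Real.arctan_tan (by linarith [hθ.2]) (by linarith)]
    congr 1
    ring

theorem drivesCircularSlit_slitDriving : DrivesCircularSlit slitDriving (Real.pi ^ 2 / 6) := by
  have hpi := Real.pi_pos
  refine ⟨by positivity, continuousOn_slitDriving, fun t ht => ?_⟩
  rcases ht.1.eq_or_lt with h | h
  · refine ⟨0, ⟨le_rfl, by positivity⟩, ?_⟩
    rw [← h, circularSlit_zero, loewnerHull_zero]
  · refine ⟨_, ⟨?_, ?_⟩, loewnerHull_slitDriving ⟨h, ht.2⟩⟩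
    · linarith [Real.arctan_lt_pi_div_two (slitTip (slitParam t) / Real.pi)]
    · linarith [Real.neg_pi_div_two_lt_arctan (slitTip (slitParam t) / Real.pi)]

/-! ### Reduction of an arbitrary driving term to the explicit one. -/

/-- A driving term of the circular slit has the same hulls as `slitDriving`. -/
theorem DrivesCircularSlit.loewnerHull_eq {lam : ℝ → ℝ} {T : ℝ} (h : DrivesCircularSlit lam T)
    {t : ℝ} (ht : t ∈ Ico 0 T) :
    t < Real.pi ^ 2 / 6 ∧ loewnerHull lam t = loewnerHull slitDriving t := by
  obtain ⟨θ, hθ, e⟩ := h.2.2 t ht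
  obtain ⟨t', ht', e'⟩ := exists_loewnerHull_slitDriving_eq hθ
  have e2 := e.trans e'.symm
  -- A priori the explicit flow reaches the arc at some other time `t'`; capacity forces `t' = t`,
  -- which also bounds `t` by `π²/6`.
  have := time_eq_of_loewnerHull_eq ht.1 ht'.1 (h.2.1.mono (Icc_subset_Ico_right ht.2))
    (continuousOn_slitDriving.mono (Icc_subset_Ico_right ht'.2)) e2
  subst this
  exact ⟨ht'.2, e2⟩

theorem DrivesCircularSlit.Ico_subset {lam : ℝ → ℝ} {T : ℝ} (h : DrivesCircularSlit lam T) :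
    Ico 0 T ⊆ Ico 0 (Real.pi ^ 2 / 6) := fun _ ht => ⟨ht.1, (h.loewnerHull_eq ht).1⟩

/-- The driving term of the circular slit is unique. -/
theorem DrivesCircularSlit.eqOn {lam : ℝ → ℝ} {T : ℝ} (h : DrivesCircularSlit lam T) :
    EqOn lam slitDriving (Ico 0 T) := by
  have hpos : ∀ t ∈ Ioo 0 T, lam t = slitDriving t := fun t ht =>
    driving_eq_of_loewnerHull_eq ht.1 (h.2.1.mono (Icc_subset_Ico_right ht.2))
      (continuousOn_slitDriving.mono
        (Icc_subset_Ico_right (h.Ico_subset (Ioo_subset_Ico_self ht)).2))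
      fun s hs => (h.loewnerHull_eq ⟨hs.1, hs.2.trans_lt ht.2⟩).2
  intro t ht
  rcases ht.1.eq_or_lt with h0 | h0
  -- Hulls say nothing about the driving term at time `0` itself, so that value is recovered by
  -- continuity.
  · subst h0
    have h1 : Tendsto lam (𝓝[Ioo 0 T] 0) (𝓝 (lam 0)) := (h.2.1 0 ht).mono Ioo_subset_Ico_self
    have h2 : Tendsto slitDriving (𝓝[Ioo 0 T] 0) (𝓝 (slitDriving 0)) :=
      (continuousOn_slitDriving 0 (h.Ico_subset ht)).mono
        (Ioo_subset_Ico_self.trans h.Ico_subset)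
    have : (𝓝[Ioo 0 T] (0 : ℝ)).NeBot := by
      rw [nhdsWithin_Ioo_eq_nhdsGT h.1]
      infer_instance
    refine tendsto_nhds_unique (h1.congr' ?_) h2
    filter_upwards [self_mem_nhdsWithin] with t ht using hpos t ht
  · exact hpos t ⟨h0, ht.2⟩

/-- Equality of the predicates, not mere equivalence pointwise, makes the choices inside
`loewnerMap` coincide. -/
theorem isLoewnerSolution_congr {lam mu : ℝ → ℝ} {t : ℝ} (h : EqOn lam mu (Icc 0 t)) :
    (fun z g => IsLoewnerSolution lam z t g) = fun z g => IsLoewnerSolution mu z t g := by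
  funext z g
  refine propext (and_congr_right fun _ => forall₂_congr fun s hs => ?_)
  rw [h hs]

theorem hullImage_congr {lam mu : ℝ → ℝ} {t : ℝ} (h : EqOn lam mu (Icc 0 t)) :
    hullImage lam t = hullImage mu t := by
  have h1 : ∀ z, IsLoewnerSolution lam z t = IsLoewnerSolution mu z t := fun z =>
    congrFun (isLoewnerSolution_congr h) z
  have h2 : loewnerHull lam t = loewnerHull mu t := by
    simp only [loewnerHull, h1]
  have h3 : loewnerMap lam t = loewnerMap mu t := by
    funext z
    unfold loewnerMap
    rw [h1 z]
  rw [hullImage, hullImage, h2, h3]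

/-! ### The image of the slit under the boundary extension. -/

theorem eq_zero_or_mem_of_mem_closure_circularSlit {θ : ℝ} {p : ℂ}
    (hp : p ∈ closure (circularSlit θ)) : p = 0 ∨ p ∈ circularSlit θ := by
  have hcl : IsClosed ((fun u : ℝ => Complex.I - Complex.I * Complex.exp (u * Complex.I))
      '' Icc 0 θ) := (isCompact_Icc.image (by fun_prop)).isClosed
  have hsub : circularSlit θ ⊆ (fun u : ℝ => Complex.I - Complex.I * Complex.exp (u * Complex.I))
      '' Icc 0 θ := fun z ⟨u, h0, h1, hz⟩ => ⟨u, ⟨h0.le, h1⟩, hz.symm⟩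
  obtain ⟨u, hu, rfl⟩ := closure_minimal hsub hcl hp
  rcases hu.1.eq_or_lt with h | h
  · left
    simp [← h]
  · exact Or.inr ⟨u, h, hu.2, rfl⟩

theorem zero_mem_closure_circularSlit {θ : ℝ} (hθ : 0 < θ) : (0 : ℂ) ∈ closure (circularSlit θ) := by
  have h : Tendsto (fun u : ℝ => Complex.I - Complex.I * Complex.exp (u * Complex.I))
      (𝓝[>] 0) (𝓝 0) := by
    have : Continuous fun u : ℝ => Complex.I - Complex.I * Complex.exp (u * Complex.I) := by
      fun_prop
    have := this.tendsto 0
    simp only [Complex.ofReal_zero, zero_mul, Complex.exp_zero, mul_one, sub_self] at this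
    exact this.mono_left nhdsWithin_le_nhds
  refine mem_closure_of_tendsto h ?_
  filter_upwards [Ioc_mem_nhdsGT hθ] with u hu using ⟨u, hu.1, hu.2, rfl⟩

theorem continuousAt_slitInvariant {r : ℝ} {w : ℂ} (h0 : w + Real.pi * (r : ℂ) ^ 2 ≠ 0)
    (h : 1 - 2 * Real.pi * r / (w + Real.pi * (r : ℂ) ^ 2) ∈ Complex.slitPlane) :
    ContinuousAt (slitInvariant r) w := by
  have hu : ContinuousAt (fun w : ℂ => w + Real.pi * (r : ℂ) ^ 2) w := by fun_prop
  exact (continuousAt_const.div hu h0).add ((continuousAt_const.sub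
    (continuousAt_const.div hu h0)).clog h)

/-- Outside the closed interval between the two poles, the invariant is regular and real on the
real line. -/
theorem slitInvariant_regular_of_real {r x : ℝ} (hr : 0 < r)
    (hx : x < -Real.pi * r ^ 2 ∨ 2 * Real.pi * r - Real.pi * r ^ 2 < x) :
    (x : ℂ) + Real.pi * (r : ℂ) ^ 2 ≠ 0 ∧
      1 - 2 * Real.pi * r / ((x : ℂ) + Real.pi * (r : ℂ) ^ 2) ∈ Complex.slitPlane ∧
      (slitInvariant r x).im = 0 := by
  have hpi := Real.pi_pos
  have hpr : 0 < 2 * Real.pi * r := by positivity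
  obtain ⟨a, ha⟩ : ∃ a, a = x + Real.pi * r ^ 2 := ⟨_, rfl⟩
  have e : (x : ℂ) + Real.pi * (r : ℂ) ^ 2 = (a : ℂ) := by rw [ha]; push_cast; rfl
  have e2 : 1 - 2 * Real.pi * r / (a : ℂ) = ((1 - 2 * Real.pi * r / a : ℝ) : ℂ) := by
    push_cast
    rfl
  have ha' : a < 0 ∨ 2 * Real.pi * r < a := by
    rcases hx with h | h
    · left; linarith
    · right; linarith
  have ha0 : a ≠ 0 := by
    rcases ha' with h | h
    · exact h.ne
    · exact (hpr.trans h).ne'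
  have hpos : 0 < 1 - 2 * Real.pi * r / a := by
    rcases ha' with h | h
    · have := div_neg_of_pos_of_neg hpr h
      linarith
    · rw [sub_pos, div_lt_one (hpr.trans h)]
      exact h
  refine ⟨by rw [e]; exact_mod_cast ha0, ?_, ?_⟩
  · rw [e, e2]
    exact Complex.ofReal_mem_slitPlane.2 hpos
  · have e3 : -(2 * Real.pi * (1 - r)) / (a : ℂ) = ((-(2 * Real.pi * (1 - r)) / a : ℝ) : ℂ) := by
      push_cast
      rfl
    rw [slitInvariant, e, e2, ← Complex.ofReal_log hpos.le, e3, ← Complex.ofReal_add,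
      Complex.ofReal_im]

/-- Where the invariant is continuous, its value at a cluster value must lie on the removed ray.
This excludes the open half-plane, where the ray is omitted, and the reals outside the interval,
where the invariant is real. -/
theorem mem_interval_of_mem_hullImage {t : ℝ} (ht : t ∈ Ioo 0 (Real.pi ^ 2 / 6)) {w₀ : ℂ}
    (h : w₀ ∈ hullImage slitDriving t) :
    w₀ ∈ (fun x : ℝ => (x : ℂ)) '' Icc (slitLeft t) (slitRight t) := by
  have ht' := Ioo_subset_Ico_self ht
  have hr := slitParam_pos ht
  have hlam : ContinuousOn slitDriving (Icc 0 t) :=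
    continuousOn_slitDriving.mono (Icc_subset_Ico_right ht.2)
  obtain ⟨p, hp, hw⟩ := h
  obtain ⟨U, hU, hUw⟩ := mapClusterPt_iff_ultrafilter.1 hw
  have hUp : Tendsto id (U : Filter ℂ) (𝓝 p) := hU.trans nhdsWithin_le_nhds
  have hUS : ∀ᶠ z in (U : Filter ℂ), z ∈ upperHalf \ loewnerHull slitDriving t :=
    hU self_mem_nhdsWithin
  have him : 0 ≤ w₀.im := by
    refine ge_of_tendsto ((Complex.continuous_im.tendsto w₀).comp hUw) ?_
    filter_upwards [hUS] with z hz using le_of_lt (loewnerMap_mem ht.1.le hlam hz)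
  -- The product form of the conservation law survives the limit even when `p = 0`, a case it then
  -- rules out.
  have hlim : ContinuousAt (slitInvariant (slitParam t)) w₀ →
      slitInvariant (slitParam t) w₀ * p = -(2 * Real.pi) := by
    intro hc
    refine tendsto_nhds_unique ((hc.tendsto.comp hUw).mul hUp)
      (tendsto_const_nhds.congr' ?_)
    filter_upwards [hUS] with z hz
    simp only [Function.comp_apply, id]
    rw [slitInvariant_eq ht' (loewnerMap_mem ht.1.le hlam hz),
      loewnerInv_loewnerMap ht.1.le hlam hz, div_mul_cancel₀ _ (ne_zero_of_mem_upperHalf hz.1)]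
  have hval : ContinuousAt (slitInvariant (slitParam t)) w₀ →
      (slitInvariant (slitParam t) w₀).im = Real.pi ∧
        (slitInvariant (slitParam t) w₀).re ≤ -slitTip (slitParam t) := by
    intro hc
    have h1 := hlim hc
    rw [loewnerHull_slitDriving ht] at hp
    rcases eq_zero_or_mem_of_mem_closure_circularSlit hp with h0 | h0
    · rw [h0, mul_zero] at h1
      have : (-(2 * Real.pi) : ℝ) = 0 := by exact_mod_cast h1.symm
      linarith [Real.pi_pos]
    · rw [mem_circularSlit_iff, mul_div_cancel₀ _ Real.pi_ne_zero] at h0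
      obtain ⟨x, hx, rfl⟩ := h0
      have h2 : -(2 * Real.pi) / (x + Real.pi * Complex.I : ℂ) ≠ 0 := by
        intro h3
        rw [h3, mul_zero] at h1
        have : (-(2 * Real.pi) : ℝ) = 0 := by exact_mod_cast h1.symm
        linarith [Real.pi_pos]
      rw [← eq_div_iff h2, neg_two_pi_div_neg_two_pi_div] at h1
      rw [h1]
      simpa using hx
  rcases him.eq_or_lt with h0 | h0
  · have hx : w₀ = (w₀.re : ℂ) := Complex.ext rfl (by simp [← h0])
    refine ⟨w₀.re, ?_, hx.symm⟩
    by_contra hcon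
    have hout : w₀.re < -Real.pi * slitParam t ^ 2 ∨
        2 * Real.pi * slitParam t - Real.pi * slitParam t ^ 2 < w₀.re := by
      rw [mem_Icc, not_and_or, not_le, not_le] at hcon
      exact hcon
    obtain ⟨h1, h2, h3⟩ := slitInvariant_regular_of_real hr.1 hout
    rw [← hx] at h1 h2 h3
    have := (hval (continuousAt_slitInvariant h1 h2)).1
    rw [h3] at this
    exact Real.pi_pos.ne this
  · have hw₀ : w₀ ∈ upperHalf := h0
    have := hval (continuousAt_slitInvariant
      (ne_zero_of_mem_upperHalf (add_ofReal_mem_upperHalf hw₀ _))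
      (one_sub_div_mem_slitPlane hw₀ hr.1.le))
    exact absurd this (slitInvariant_mem hr hw₀).2

/-- Approaching `x` vertically in the image plane and pulling back by the inverse map produces
points `z`, given explicitly by the invariant. -/
theorem mem_hullImage_of_tendsto {t x : ℝ} (ht : t ∈ Ioo 0 (Real.pi ^ 2 / 6)) {p : ℂ}
    (hp : p ∈ closure (loewnerHull slitDriving t))
    (h : Tendsto (fun y : ℝ => -(2 * Real.pi) / slitInvariant (slitParam t) (x + y * Complex.I))
      (𝓝[>] 0) (𝓝 p)) : (x : ℂ) ∈ hullImage slitDriving t := by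
  have ht' := Ioo_subset_Ico_self ht
  have hlam : ContinuousOn slitDriving (Icc 0 t) :=
    continuousOn_slitDriving.mono (Icc_subset_Ico_right ht.2)
  have hmem : ∀ᶠ y : ℝ in 𝓝[>] 0, (x + y * Complex.I : ℂ) ∈ upperHalf := by
    filter_upwards [self_mem_nhdsWithin] with y hy
    simpa [upperHalf] using hy
  refine ⟨p, hp, MapClusterPt.of_comp
    (φ := fun y : ℝ => loewnerInv slitDriving t (x + y * Complex.I)) (p := 𝓝[>] 0) ?_ ?_⟩
  · refine tendsto_nhdsWithin_iff.2 ⟨h.congr' ?_, ?_⟩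
    · filter_upwards [hmem] with y hy
      rw [slitInvariant_eq ht' hy, neg_two_pi_div_neg_two_pi_div]
    · filter_upwards [hmem] with y hy using loewnerInv_mem ht.1.le hlam hy
  · have hlim : Tendsto (fun y : ℝ => (x + y * Complex.I : ℂ)) (𝓝[>] 0) (𝓝 (x : ℂ)) := by
      have : Continuous fun y : ℝ => (x + y * Complex.I : ℂ) := by fun_prop
      have := this.tendsto 0
      simp only [Complex.ofReal_zero, zero_mul, add_zero] at this
      exact this.mono_left nhdsWithin_le_nhds
    refine (hlim.congr' ?_).mapClusterPt
    filter_upwards [hmem] with y hy using (loewnerMap_loewnerInv ht.1.le hlam hy).symm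

theorem mem_hullImage_of_norm_tendsto {t x : ℝ} (ht : t ∈ Ioo 0 (Real.pi ^ 2 / 6))
    (h : Tendsto (fun y : ℝ => ‖slitInvariant (slitParam t) (x + y * Complex.I)‖)
      (𝓝[>] 0) atTop) : (x : ℂ) ∈ hullImage slitDriving t := by
  refine mem_hullImage_of_tendsto ht (p := 0) ?_ ?_
  · rw [loewnerHull_slitDriving ht]
    refine zero_mem_closure_circularSlit ?_
    linarith [Real.arctan_lt_pi_div_two (slitTip (slitParam t) / Real.pi)]
  · have h1 := (tendsto_inv₀_cobounded.comp (tendsto_norm_atTop_iff_cobounded.1 h)).const_mul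
      (-(2 * Real.pi) : ℂ)
    rw [mul_zero] at h1
    exact h1

/-- Here the invariant has its pole. On the vertical through it the pole term has imaginary part
`2π(1 - r)/y`, and the argument in the logarithm is nonnegative and cannot cancel it. -/
theorem slitLeft_mem_hullImage {t : ℝ} (ht : t ∈ Ioo 0 (Real.pi ^ 2 / 6)) :
    (slitLeft t : ℂ) ∈ hullImage slitDriving t := by
  have hr := slitParam_pos ht
  have hA : 0 < 2 * Real.pi * (1 - slitParam t) := mul_pos Real.two_pi_pos (sub_pos.2 hr.2)
  refine mem_hullImage_of_norm_tendsto ht (tendsto_atTop_mono' _ ?_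
    (tendsto_inv_nhdsGT_zero.const_mul_atTop hA))
  filter_upwards [self_mem_nhdsWithin] with y hy
  have hy0 : 0 < y := hy
  have hw : (slitLeft t + y * Complex.I : ℂ) ∈ upperHalf := by simpa [upperHalf] using hy0
  have hζ := one_sub_div_mem_upperHalf (add_ofReal_mem_upperHalf hw (slitParam t))
    (a := 2 * Real.pi * slitParam t) (mul_pos Real.two_pi_pos hr.1)
  push_cast at hζ
  refine le_trans ?_ ((le_abs_self _).trans (Complex.abs_im_le_norm _))
  have e : (slitLeft t + y * Complex.I + Real.pi * (slitParam t : ℂ) ^ 2 : ℂ) = y * Complex.I := by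
    simp only [slitLeft]
    push_cast
    ring
  have hy1 : (y : ℂ) ≠ 0 := by exact_mod_cast hy0.ne'
  have e2 : -(2 * Real.pi * (1 - slitParam t)) / (y * Complex.I : ℂ)
      = ((2 * Real.pi * (1 - slitParam t) * y⁻¹ : ℝ) : ℂ) * Complex.I := by
    push_cast
    field_simp
    rw [Complex.I_sq]
    ring
  have harg := Complex.arg_nonneg_iff.2 (le_of_lt hζ)
  rw [slitInvariant, Complex.add_im, Complex.log_im]
  rw [e] at harg ⊢
  rw [e2, Complex.im_ofReal_mul, Complex.I_im, mul_one]
  linarith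

/-- Here the logarithm has its singularity: its real part tends to `-∞` while the other term stays
bounded. -/
theorem slitRight_mem_hullImage {t : ℝ} (ht : t ∈ Ioo 0 (Real.pi ^ 2 / 6)) :
    (slitRight t : ℂ) ∈ hullImage slitDriving t := by
  have hr := slitParam_pos ht
  have hpr : 0 < 2 * Real.pi * slitParam t := mul_pos Real.two_pi_pos hr.1
  have hpr' : (2 * Real.pi * slitParam t : ℂ) ≠ 0 := by exact_mod_cast hpr.ne'
  have hu : Tendsto (fun y : ℝ => (slitRight t + y * Complex.I
      + Real.pi * (slitParam t : ℂ) ^ 2 : ℂ)) (𝓝[>] 0) (𝓝 (2 * Real.pi * slitParam t)) := by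
    have : Continuous fun y : ℝ => (slitRight t + y * Complex.I
      + Real.pi * (slitParam t : ℂ) ^ 2 : ℂ) := by fun_prop
    have := this.tendsto 0
    have e : (slitRight t + (0 : ℝ) * Complex.I + Real.pi * (slitParam t : ℂ) ^ 2 : ℂ)
        = 2 * Real.pi * slitParam t := by
      simp only [slitRight]
      push_cast
      ring
    rw [e] at this
    exact this.mono_left nhdsWithin_le_nhds
  have h1 := (Complex.continuous_re.tendsto _).comp ((tendsto_const_nhds
    (x := (-(2 * Real.pi * (1 - slitParam t)) : ℂ))).div hu hpr')
  have h2 : Tendsto (fun y : ℝ => ‖1 - 2 * Real.pi * slitParam t / (slitRight t + y * Complex.I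
      + Real.pi * (slitParam t : ℂ) ^ 2 : ℂ)‖) (𝓝[>] 0) (𝓝[>] 0) := by
    refine tendsto_nhdsWithin_iff.2 ⟨?_, ?_⟩
    · have := ((tendsto_const_nhds (x := (1 : ℂ))).sub
        ((tendsto_const_nhds (x := (2 * Real.pi * slitParam t : ℂ))).div hu hpr')).norm
      rw [div_self hpr', sub_self, norm_zero] at this
      exact this
    · filter_upwards [self_mem_nhdsWithin] with y hy
      have hw : (slitRight t + y * Complex.I : ℂ) ∈ upperHalf := by simpa [upperHalf] using hy
      exact norm_pos_iff.2 (Complex.slitPlane_ne_zero (one_sub_div_mem_slitPlane hw hr.1.le))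
  have h3 := h1.add_atBot (Real.tendsto_log_nhdsGT_zero.comp h2)
  refine mem_hullImage_of_norm_tendsto ht (tendsto_atTop_mono' _ ?_
    (tendsto_abs_atBot_atTop.comp h3))
  filter_upwards with y
  refine le_trans (le_of_eq ?_) (Complex.abs_re_le_norm _)
  rw [slitInvariant, Complex.add_re, Complex.log_re]
  rfl

theorem mem_hullImage_of_mem_Ioo {t x : ℝ} (ht : t ∈ Ioo 0 (Real.pi ^ 2 / 6))
    (hx : x ∈ Ioo (slitLeft t) (slitRight t)) : (x : ℂ) ∈ hullImage slitDriving t := by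
  have hr := slitParam_pos ht
  have hpr : 0 < 2 * Real.pi * slitParam t := mul_pos Real.two_pi_pos hr.1
  obtain ⟨r, hrdef⟩ : ∃ r, r = slitParam t := ⟨_, rfl⟩
  obtain ⟨a, ha⟩ : ∃ a, a = x + Real.pi * r ^ 2 := ⟨_, rfl⟩
  simp only [slitLeft, slitRight, ← hrdef] at hx
  rw [← hrdef] at hr hpr
  have ha0 : 0 < a := by linarith [hx.1]
  have ha1 : a < 2 * Real.pi * r := by linarith [hx.2]
  -- `-s` is the boundary value of `ζ` at `x`. Since `ζ` reaches the negative axis from above, the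
  -- logarithm tends to `log s + iπ`.
  obtain ⟨s, hs⟩ : ∃ s, s = 2 * Real.pi * r / a - 1 := ⟨_, rfl⟩
  have hs0 : 0 < s := by
    rw [hs, sub_pos, one_lt_div ha0]
    exact ha1
  have ha0' : (a : ℂ) ≠ 0 := by exact_mod_cast ha0.ne'
  have hu : Tendsto (fun y : ℝ => (x + y * Complex.I + Real.pi * (r : ℂ) ^ 2 : ℂ)) (𝓝[>] 0)
      (𝓝 (a : ℂ)) := by
    have : Continuous fun y : ℝ => (x + y * Complex.I + Real.pi * (r : ℂ) ^ 2 : ℂ) := by fun_prop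
    have := this.tendsto 0
    have e : (x + (0 : ℝ) * Complex.I + Real.pi * (r : ℂ) ^ 2 : ℂ) = a := by
      rw [ha]
      push_cast
      ring
    rw [e] at this
    exact this.mono_left nhdsWithin_le_nhds
  have h1 := (tendsto_const_nhds (x := (-(2 * Real.pi * (1 - r)) : ℂ))).div hu ha0'
  have hζ : Tendsto (fun y : ℝ => 1 - 2 * Real.pi * r / (x + y * Complex.I
      + Real.pi * (r : ℂ) ^ 2 : ℂ)) (𝓝[>] 0) (𝓝[{z : ℂ | 0 ≤ z.im}] ((-s : ℝ) : ℂ)) := by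
    refine tendsto_nhdsWithin_iff.2 ⟨?_, ?_⟩
    · have := (tendsto_const_nhds (x := (1 : ℂ))).sub
        ((tendsto_const_nhds (x := (2 * Real.pi * r : ℂ))).div hu ha0')
      have e : (1 : ℂ) - 2 * Real.pi * r / a = ((-s : ℝ) : ℂ) := by
        rw [hs]
        push_cast
        ring
      rw [e] at this
      exact this
    · filter_upwards [self_mem_nhdsWithin] with y hy
      have hw : (x + y * Complex.I : ℂ) ∈ upperHalf := by simpa [upperHalf] using hy
      have := one_sub_div_mem_upperHalf (add_ofReal_mem_upperHalf hw r) hpr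
      push_cast at this
      exact le_of_lt this
  have hlog := Complex.tendsto_log_nhdsWithin_im_nonneg_of_re_neg_of_im_zero
    (z := ((-s : ℝ) : ℂ)) (by simpa using hs0) (by simp)
  have hE := h1.add (hlog.comp hζ)
  have hval : -(2 * Real.pi * (1 - r)) / (a : ℂ)
      + ((Real.log ‖((-s : ℝ) : ℂ)‖ : ℂ) + Real.pi * Complex.I)
      = ((-(2 * Real.pi * (1 - r)) / a + Real.log s : ℝ) : ℂ) + Real.pi * Complex.I := by
    rw [Complex.norm_real, Real.norm_eq_abs, abs_neg, abs_of_pos hs0]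
    push_cast
    ring
  rw [hval] at hE
  have hne : ((-(2 * Real.pi * (1 - r)) / a + Real.log s : ℝ) : ℂ) + Real.pi * Complex.I ≠ 0 := by
    intro h
    have := congrArg Complex.im h
    simp [Real.pi_ne_zero] at this
  refine mem_hullImage_of_tendsto ht (p := -(2 * Real.pi)
    / (((-(2 * Real.pi * (1 - r)) / a + Real.log s : ℝ) : ℂ) + Real.pi * Complex.I))
    (subset_closure ?_) (hrdef ▸ tendsto_const_nhds.div hE hne)
  rw [loewnerHull_slitDriving ht, mem_circularSlit_iff, mul_div_cancel₀ _ Real.pi_ne_zero]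
  refine ⟨_, ?_, rfl⟩
  rw [slitTip, ← hrdef]
  have hP : 0 < (1 - r) / r := div_pos (sub_pos.2 hr.2) hr.1
  -- The inequality `log (p s) ≤ p s - 1` says that on the negative axis the real part is largest at
  -- the critical point, so the limit lies on the ray.
  have h2 := Real.log_le_sub_one_of_pos (mul_pos hP hs0)
  rw [Real.log_mul hP.ne' hs0.ne'] at h2
  have hr0 := hr.1.ne'
  have h3 : -(2 * Real.pi * (1 - r)) / a = -((1 - r) / r * (1 + s)) := by
    rw [hs]
    field_simp
    ring
  rw [h3]
  linarith

/-- The image of the circular slit under the boundary extension of the flow map. -/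
theorem hullImage_slitDriving {t : ℝ} (ht : t ∈ Ioo 0 (Real.pi ^ 2 / 6)) :
    hullImage slitDriving t = (fun x : ℝ => (x : ℂ)) '' Icc (slitLeft t) (slitRight t) := by
  refine Subset.antisymm (fun w hw => mem_interval_of_mem_hullImage ht hw) ?_
  rintro _ ⟨x, hx, rfl⟩
  rcases hx.1.eq_or_lt with h | h
  · exact h ▸ slitLeft_mem_hullImage ht
  rcases hx.2.eq_or_lt with h' | h'
  · exact h' ▸ slitRight_mem_hullImage ht
  · exact mem_hullImage_of_mem_Ioo ht ⟨h, h'⟩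

/-! ### Assembly. -/

theorem mainTheorem2 :
    -- the flow exists, and it runs through the whole circle
    (∃ (lam : ℝ → ℝ) (T : ℝ), DrivesCircularSlit lam T ∧
      ∀ θ ∈ Ico (0 : ℝ) (2 * Real.pi), ∃ t ∈ Ico (0 : ℝ) T,
        loewnerHull lam t = circularSlit θ) ∧
    -- its driving term and the endpoints of the image interval
    (∀ (lam : ℝ → ℝ) (T : ℝ), DrivesCircularSlit lam T →
      lam 0 = 0 ∧
      (∃ R : ℝ → ℝ, AnalyticAt ℝ R 0 ∧ ∀ᶠ t in 𝓝[≥] (0 : ℝ),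
        lam t = lam 0 + (12 * Real.pi) ^ (1 / 3 : ℝ) * t ^ (1 / 3 : ℝ)
          + t ^ (2 / 3 : ℝ) * R (t ^ (1 / 3 : ℝ))) ∧
      (∃ C : NNReal, HolderOnWith C (1 / 3) lam (Ico 0 T)) ∧
      AnalyticOnNhd ℝ lam (Ioo 0 T) ∧
      ∃ α β : ℝ → ℝ,
        (∀ t ∈ Ioo (0 : ℝ) T,
          hullImage lam t = (fun x : ℝ => (x : ℂ)) '' Icc (α t) (β t) ∧
          α t < lam t ∧ lam t < β t ∧
          HasDerivAt α (2 / (α t - lam t)) t ∧ HasDerivAt β (2 / (β t - lam t)) t) ∧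
        (∃ R : ℝ → ℝ, AnalyticAt ℝ R 0 ∧ ∀ᶠ t in 𝓝[>] (0 : ℝ),
          α t = -(9 / (4 * Real.pi)) ^ (1 / 3 : ℝ) * t ^ (2 / 3 : ℝ)
            + t * R (t ^ (1 / 3 : ℝ))) ∧
        (∃ R : ℝ → ℝ, AnalyticAt ℝ R 0 ∧ ∀ᶠ t in 𝓝[>] (0 : ℝ),
          β t = (12 * Real.pi) ^ (1 / 3 : ℝ) * t ^ (1 / 3 : ℝ)
            + t ^ (2 / 3 : ℝ) * R (t ^ (1 / 3 : ℝ)))) := by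
  refine ⟨⟨slitDriving, Real.pi ^ 2 / 6, drivesCircularSlit_slitDriving,
    fun θ hθ => exists_loewnerHull_slitDriving_eq hθ⟩, fun lam T h => ?_⟩
  have heq := h.eqOn
  have hsub := h.Ico_subset
  have hsub' : Ioo 0 T ⊆ Ioo 0 (Real.pi ^ 2 / 6) := fun t ht =>
    ⟨ht.1, (hsub (Ioo_subset_Ico_self ht)).2⟩
  have h0 : lam 0 = 0 := by
    rw [heq ⟨le_rfl, h.1⟩, slitDriving, slitParam_zero, mul_zero, zero_mul]
  refine ⟨h0, ?_, ⟨4 * NNReal.pi, ?_⟩, ?_, slitLeft, slitRight, fun t ht => ?_, ?_, ?_⟩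
  · obtain ⟨R, hR, hev⟩ := exists_slitDriving_eq
    refine ⟨R, hR, ?_⟩
    filter_upwards [hev, Ico_mem_nhdsGE h.1] with t ht htT
    rw [heq htT, ht, h0, zero_add]
  · intro x hx y hy
    rw [heq hx, heq hy]
    exact holderOnWith_slitDriving x (hsub hx) y (hsub hy)
  · intro t ht
    refine (analyticOnNhd_slitDriving t (hsub' ht)).congr ?_
    filter_upwards [isOpen_Ioo.mem_nhds ht] with s hs using (heq (Ioo_subset_Ico_self hs)).symm
  · have ht' := hsub' ht
    rw [hullImage_congr (heq.mono (Icc_subset_Ico_right ht.2)), heq (Ioo_subset_Ico_self ht)]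
    exact ⟨hullImage_slitDriving ht', slitLeft_lt_slitDriving ht', slitDriving_lt_slitRight ht',
      hasDerivAt_slitLeft ht', hasDerivAt_slitRight ht'⟩
  · obtain ⟨R, hR, hev⟩ := exists_slitLeft_eq
    exact ⟨R, hR, hev.filter_mono (nhdsWithin_mono _ Ioi_subset_Ici_self)⟩
  · obtain ⟨R, hR, hev⟩ := exists_slitRight_eq
    exact ⟨R, hR, hev.filter_mono (nhdsWithin_mono _ Ioi_subset_Ici_self)⟩
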